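/- **Definitions.** A lattice $\Lambda\subset\mathbb R^n$ is a discrete subgroup spanning $\mathbb R^n$; it is *unimodular* if $(x,y)\in\mathbb Z$ for all $x,y\in\Lambda$ and it has determinant $1$. For $\operatorname{Im} z>0$ put $\Theta_\Lambda(z)=\sum_{x\in\Lambda}e^{\pi i\|x\|^2z}$. The *Belfiore–Solé conjecture* says that for every $n$ and every unimodular lattice $\Lambda\subset\mathbb R^n$ the secrecy function $$\Xi_\Lambda(y)=\frac{\Theta_{\mathbb Z^n}(yi)}{\Theta_\Lambda(yi)},\qquad y>0,$$ attains its maximum at $y=1$. A vector $w\in\Lambda$ is *characteristic* if $(w,v)\equiv(v,v)\pmod 2$ for all $v\in\Lambda$. An *$n-8k$ lattice* is a unimodular lattice $\Lambda\subset\mathbb R^n$ all of whose characteristic vectors $w$ satisfy $(w,w)\ge n-8k$. **Theorem.** Assume that the Belfiore–Solé conjecture holds. Then for every integer $k\ge 2$ there is an $N_k$ such that for every dimension $n>N_k$ there is no $n-8k$ lattice $\Lambda\subset\mathbb R^n$ with $(v,v)\ge k$ for all nonzero $v\in\Lambda$. -/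

import Mathlib

noncomputable section

/-- A unimodular lattice in Euclidean `n`-space: a full-rank discrete subgroup of `ℝⁿ` with integral
inner products and determinant one (a fundamental parallelotope has volume one). -/
structure IsUnimodularLattice {n : ℕ} (Λ : Submodule ℤ (EuclideanSpace ℝ (Fin n))) : Prop where
  discrete : DiscreteTopology Λ
  spans : Submodule.span ℝ (Λ : Set (EuclideanSpace ℝ (Fin n))) = ⊤
  integral : ∀ x ∈ Λ, ∀ y ∈ Λ, ∃ m : ℤ, inner ℝ x y = (m : ℝ)
  covolume_eq_one : ZLattice.covolume Λ = 1

/-- The lattice `ℤⁿ` in Euclidean `n`-space. -/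
def integerLattice (n : ℕ) : Submodule ℤ (EuclideanSpace ℝ (Fin n)) :=
  Submodule.span ℤ (Set.range (EuclideanSpace.basisFun (Fin n) ℝ))

/-- The theta function `Θ_Λ(z) = ∑_{x ∈ Λ} exp(π i ‖x‖² z)`. -/
def latticeTheta {n : ℕ} (Λ : Submodule ℤ (EuclideanSpace ℝ (Fin n))) (z : ℂ) : ℂ :=
  ∑' x : Λ, Complex.exp (Real.pi * Complex.I * ((‖(x : EuclideanSpace ℝ (Fin n))‖ ^ 2 : ℝ) : ℂ) * z)

/-- The secrecy function `Ξ_Λ(y) = Θ_{ℤⁿ}(yi) / Θ_Λ(yi)`, meant for `y > 0`.  The quotient is real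
(see `latticeTheta_imaginary_axis`), and the real part only turns it into an element of `ℝ`. -/
def secrecyFunction {n : ℕ} (Λ : Submodule ℤ (EuclideanSpace ℝ (Fin n))) (y : ℝ) : ℝ :=
  (latticeTheta (integerLattice n) (y * Complex.I) / latticeTheta Λ (y * Complex.I)).re

theorem latticeTheta_imaginary_axis {n : ℕ} (Λ : Submodule ℤ (EuclideanSpace ℝ (Fin n))) (y : ℝ) :
    latticeTheta Λ (y * Complex.I) =
      ((∑' x : Λ, Real.exp (-Real.pi * ‖(x : EuclideanSpace ℝ (Fin n))‖ ^ 2 * y) : ℝ) : ℂ) := by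
  rw [latticeTheta, Complex.ofReal_tsum]
  refine tsum_congr fun x => ?_
  rw [Complex.ofReal_exp]
  congr 1
  push_cast
  linear_combination
    ((Real.pi : ℂ) * (‖(x : EuclideanSpace ℝ (Fin n))‖ : ℂ) ^ 2 * (y : ℂ)) * Complex.I_mul_I

/-- The conjecture of Belfiore and Solé: for every unimodular lattice, of any dimension, the secrecy
function attains its maximum over `y > 0` at `y = 1`. -/
def BelfioreSoleConjecture : Prop :=
  ∀ (n : ℕ) (Λ : Submodule ℤ (EuclideanSpace ℝ (Fin n))), IsUnimodularLattice Λ →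
    IsMaxOn (secrecyFunction Λ) (Set.Ioi 0) 1

/-- `w ∈ Λ` is a characteristic vector of `Λ` if `(w, v) ≡ (v, v) (mod 2)` for all `v ∈ Λ`. -/
def IsCharacteristicVector {n : ℕ} (Λ : Submodule ℤ (EuclideanSpace ℝ (Fin n)))
    (w : EuclideanSpace ℝ (Fin n)) : Prop :=
  w ∈ Λ ∧ ∀ v ∈ Λ, ∃ m : ℤ, inner ℝ w v - inner ℝ v v = 2 * (m : ℝ)

/-- An `n - 8k` lattice: a unimodular lattice in dimension `n` all of whose characteristic vectors
have norm `(w, w)` at least `n - 8k`. -/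
structure IsNSubEightLattice {n : ℕ} (k : ℕ) (Λ : Submodule ℤ (EuclideanSpace ℝ (Fin n))) :
    Prop where
  unimodular : IsUnimodularLattice Λ
  le_norm_sq : ∀ w, IsCharacteristicVector Λ w → (n : ℝ) - 8 * (k : ℝ) ≤ ‖w‖ ^ 2

end

/-! Let `Λ` be an `n - 8k` lattice of minimum at least `k`. Its theta series is a combination of
`θ₃ⁿ⁻⁸ʲ Δ₈ʲ` with `j ≤ k` (`exists_theta_expansion`). Since `Θ_Λ = 1 + N qᵏ + ⋯`, the coefficients
with `j < k` are forced by a triangular recursion depending only on `n`, and the last one is the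
forced value plus `N`, the number of vectors of norm `k`. Dividing by `Θ_{ℤⁿ} = θ₃ⁿ` at `z = i`
gives `1 / Ξ_Λ(1) = P(n) + N tᵏ` with `t = Δ₈(i) / θ₃(i)⁸ > 0`. As `θ₃ = 1 + 2q + ⋯`, the `j`-th
coefficient is asymptotic to `(-2n)ʲ / j!`, so `P(n) ~ (-2nt)ᵏ / k!`
(`exists_inv_secrecyFunction_one`).

For even `k`, `P(n)` tends to `+∞`. But `Ξ_Λ(y) → 1` as `y → ∞`, so the conjecture gives `Ξ_Λ(1) ≥
1` and hence `P(n) ≤ 1`, a contradiction for large `n`. For odd `k`, `P(n)` is negative of size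
`(2nt)ᵏ / k!`, while a polynomial dimension count bounds `N` by `2 * (n + k - 1).choose k ~ 2 nᵏ /
k!` (`card_le_of_odd_minimum`). Since `2ᵏ > 2`, the sum is eventually negative, although `1 /
Ξ_Λ(1)` is positive.

The expansion rests on triples `(A, B, C)` that `z ↦ z + 1` and `z ↦ -1 / z` permute like powers of
`θ₃, θ₄, θ₂` (`IsThetaTriple`). For a lattice, `C` is the theta series of the shadow `Λ + w / 2`,
with `w` characteristic. Subtracting a suitable combination makes `C` vanish to high order at `i∞`;
then `(A B C) ^ 8` is a level one form of weight `12 n` decaying faster than `Δⁿ`, hence zero, and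
so is `A`. -/

section
open MeasureTheory Filter Topology

/-! ### Poisson summation for `ℤᵈ`. -/

section Poisson
open UnitAddTorus

/-- The translate by `l` of the half-open unit cube. -/
def unitCube {d : Type*} (l : d → ℤ) : Set (d → ℝ) := {x | ∀ i, x i ∈ Set.Ioc (l i : ℝ) (l i + 1)}

theorem measurableSet_unitCube {d : Type*} [Fintype d] (l : d → ℤ) : MeasurableSet (unitCube l) :=
  MeasurableSet.univ_pi' fun _ => measurableSet_Ioc

theorem pairwise_disjoint_unitCube {d : Type*} :
    Pairwise (Function.onFun Disjoint (unitCube (d := d))) := by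
  intro l m hlm
  refine Set.disjoint_left.2 fun x hx hy => hlm (funext fun i => ?_)
  have h1 := hx i
  have h2 := hy i
  simp only [Set.mem_Ioc] at h1 h2
  have a : (l i : ℝ) < m i + 1 := by linarith
  have b : (m i : ℝ) < l i + 1 := by linarith
  norm_cast at a b
  omega

theorem iUnion_unitCube {d : Type*} : ⋃ l : d → ℤ, unitCube l = Set.univ := by
  refine Set.eq_univ_of_forall fun x => Set.mem_iUnion.2 ⟨fun i => ⌈x i⌉ - 1, fun i => ?_⟩
  have := Int.ceil_lt_add_one (x i)
  have := Int.le_ceil (x i)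
  simp only [Set.mem_Ioc]
  push_cast
  constructor <;> linarith

theorem setIntegral_unitCube {d : Type*} [Fintype d] {E : Type*} [NormedAddCommGroup E] [NormedSpace ℝ E]
    (g : (d → ℝ) → E) (l : d → ℤ) :
    ∫ x in unitCube l, g x = ∫ x in unitCube (0 : d → ℤ), g (x + fun i => (l i : ℝ)) := by
  have h := (measurePreserving_add_right (volume : Measure (d → ℝ))
    (fun i => (l i : ℝ))).setIntegral_preimage_emb
      (MeasurableEquiv.addRight (fun i => (l i : ℝ))).measurableEmbedding g (unitCube l)
  rw [← h]
  congr 2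
  ext x
  simp only [unitCube, Set.mem_ofPred_eq, Set.mem_preimage, Pi.add_apply, Set.mem_Ioc, Pi.zero_apply,
    Int.cast_zero, zero_add]
  refine forall_congr' fun i => ?_
  constructor <;> rintro ⟨h1, h2⟩ <;> constructor <;> linarith

theorem hasSum_setIntegral_unitCube {d : Type*} [Fintype d] {E : Type*} [NormedAddCommGroup E] [NormedSpace ℝ E]
    {g : (d → ℝ) → E} (hg : Integrable g) :
    HasSum (fun l : d → ℤ => ∫ x in unitCube (0 : d → ℤ), g (x + fun i => (l i : ℝ)))
      (∫ x, g x) := by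
  have := hasSum_integral_iUnion (μ := volume) (f := g) (s := unitCube (d := d))
    measurableSet_unitCube pairwise_disjoint_unitCube (by rw [iUnion_unitCube]; exact hg.integrableOn)
  rw [iUnion_unitCube, setIntegral_univ] at this
  simpa only [← setIntegral_unitCube] using this

theorem mFourier_coe {d : Type*} [Fintype d] (m : d → ℤ) (x : d → ℝ) :
    mFourier m (fun i => (x i : UnitAddCircle)) =
      Complex.exp (2 * Real.pi * Complex.I * ∑ i, (m i : ℂ) * x i) := by
  simp only [mFourier, ContinuousMap.coe_mk, fourier_coe_apply, Finset.mul_sum, Complex.exp_sum]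
  refine Finset.prod_congr rfl fun i _ => ?_
  congr 1
  push_cast
  ring

/-- The Poisson summation formula on `ℝᵈ`, for the lattice `ℤᵈ`. -/
theorem hasSum_poisson_pi {d : Type*} [Fintype d] {f : (d → ℝ) → ℂ} (hf : Continuous f) (hfi : Integrable f)
    (hloc : ∀ r : ℝ, ∃ u : (d → ℤ) → ℝ, Summable u ∧
      ∀ x : d → ℝ, ‖x‖ ≤ r → ∀ l : d → ℤ, ‖f (x + fun i => (l i : ℝ))‖ ≤ u l)
    {c : (d → ℤ) → ℂ}
    (hc : ∀ m, ∫ x : d → ℝ,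
      Complex.exp (-(2 * Real.pi * Complex.I * ∑ i, (m i : ℂ) * x i)) * f x = c m)
    (hcs : Summable c) (x : d → ℝ) :
    HasSum (fun m => c m * Complex.exp (2 * Real.pi * Complex.I * ∑ i, (m i : ℂ) * x i))
      (∑' l : d → ℤ, f (x + fun i => (l i : ℝ))) := by
  set P : (d → ℝ) → ℂ := fun x => ∑' l : d → ℤ, f (x + fun i => (l i : ℝ)) with hP
  -- The domination in `hloc` is locally uniform, so the periodization converges locally uniformly.
  have hPc : Continuous P := by
    refine continuous_iff_continuousAt.2 fun x => ?_
    obtain ⟨u, hu, hb⟩ := hloc (‖x‖ + 1)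
    have : ContinuousOn P (Metric.ball x 1) := by
      refine continuousOn_tsum (fun l => (hf.comp (continuous_id.add continuous_const)).continuousOn)
        hu fun l y hy => hb y ?_ l
      have := norm_sub_norm_le y x
      rw [mem_ball_iff_norm] at hy
      linarith
    exact this.continuousAt (Metric.ball_mem_nhds x one_pos)
  have hPper : ∀ (x : d → ℝ) (l : d → ℤ), P (x + fun i => (l i : ℝ)) = P x := by
    intro x l
    simp only [hP]
    rw [← (Equiv.addLeft l).tsum_eq (fun l : d → ℤ => f (x + fun i => (l i : ℝ)))]
    refine tsum_congr fun m => ?_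
    congr 1
    ext i
    simp [add_assoc]
  let π : (d → ℝ) → UnitAddTorus d := fun x i => (x i : UnitAddCircle)
  have hπ : IsOpenQuotientMap π :=
    IsOpenQuotientMap.piMap (fun _ => QuotientAddGroup.isOpenQuotientMap_mk)
  have hPπ : ∀ x y, π x = π y → P x = P y := by
    intro x y hxy
    have : ∀ i, ∃ n : ℤ, x i = y i + n := by
      intro i
      have := congrFun hxy i
      simp only [π] at this
      rw [eq_comm, QuotientAddGroup.eq, AddSubgroup.mem_zmultiples_iff] at this
      obtain ⟨n, hn⟩ := this
      refine ⟨n, ?_⟩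
      simp only [zsmul_eq_mul, mul_one] at hn
      linarith
    choose n hn using this
    rw [← hPper y n]
    congr 1
    ext i
    simp [hn]
  have hF0 : (fun t => P (Function.surjInv hπ.surjective t)) ∘ π = P := funext fun x =>
    hPπ _ _ (Function.surjInv_eq hπ.surjective (π x))
  -- `P` is constant on the fibres of `π`, so any set-theoretic section defines the descended
  -- function, and its continuity can be tested after composing with the quotient map.
  let F : C(UnitAddTorus d, ℂ) := ⟨fun t => P (Function.surjInv hπ.surjective t),
    hπ.isQuotientMap.continuous_iff.2 (by rw [hF0]; exact hPc)⟩
  have hF : ∀ x, F (π x) = P x := congrFun hF0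
  have hcoef : mFourierCoeff F = c := by
    ext m
    rw [mFourierCoeff_eq_integral F m 0, ← hc m]
    have hcube : {x : d → ℝ | ∀ i, x i ∈ Set.Ioc ((0 : d → ℝ) i) ((0 : d → ℝ) i + 1)} =
      unitCube (0 : d → ℤ) := by simp [unitCube]
    rw [hcube]
    set e : (d → ℝ) → ℂ := fun x =>
      Complex.exp (-(2 * Real.pi * Complex.I * ∑ i, (m i : ℂ) * x i)) with he
    have he1 : ∀ x, mFourier (-m) (π x) = e x := by
      intro x
      rw [mFourier_coe, he]
      congr 1
      simp [Finset.mul_sum]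
    have hep : ∀ (x : d → ℝ) (l : d → ℤ), e (x + fun i => (l i : ℝ)) = e x := by
      intro x l
      rw [← he1, ← he1]
      congr 1
      ext i
      simp [π]
    have hen : ∀ x, ‖e x‖ = 1 := by
      intro x
      simp only [he]
      rw [show -(2 * Real.pi * Complex.I * ∑ i, (m i : ℂ) * x i) =
        ((-(2 * Real.pi * ∑ i, (m i : ℝ) * x i) : ℝ) : ℂ) * Complex.I by push_cast; ring]
      exact Complex.norm_exp_ofReal_mul_I _
    have hec : Continuous e := by fun_prop
    have hint : Integrable (fun x => e x * f x) := by
      refine hfi.bdd_mul hec.aestronglyMeasurable (c := 1) (Eventually.of_forall fun x => (hen x).le)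
    -- Unfolding: the integral over `ℝᵈ` is a sum over translates of the unit cube. The same
    -- decomposition of the norm justifies moving the sum inside the integral.
    have h1 := hasSum_setIntegral_unitCube hint
    have h2 := hasSum_setIntegral_unitCube hint.norm
    have h3 : ∀ l : d → ℤ, Integrable (fun x : d → ℝ => e (x + fun i => (l i : ℝ)) *
        f (x + fun i => (l i : ℝ))) (volume.restrict (unitCube (0 : d → ℤ))) := fun l =>
      (hint.comp_add_right _).integrableOn
    have h4 := hasSum_integral_of_summable_integral_norm h3 h2.summable
    rw [h1.unique h4]
    refine setIntegral_congr_fun (measurableSet_unitCube _) fun x _ => ?_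
    change mFourier (-m) (π x) • F (π x) = _
    rw [he1, hF, smul_eq_mul]
    simp only [hep, hP, tsum_mul_left]
  have := hasSum_mFourier_series_apply_of_summable (f := F) (by rw [hcoef]; exact hcs) (π x)
  rw [hF, hcoef] at this
  simpa only [smul_eq_mul, π, mFourier_coe] using this

end Poisson

end

/-! ### Bases and self-duality of unimodular lattices. -/

section
open MeasureTheory Module

namespace IsUnimodularLattice

variable {n : ℕ} {Λ : Submodule ℤ (EuclideanSpace ℝ (Fin n))}

/-- The Gram determinant is the square of the covolume. A fundamental parallelotope of volume one
makes the Haar measure of the basis the standard volume. -/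
theorem exists_basis (h : IsUnimodularLattice Λ) :
    ∃ (b : Basis (Fin n) ℝ (EuclideanSpace ℝ (Fin n))),
      Submodule.span ℤ (Set.range b) = Λ ∧ b.addHaar = volume ∧
        ∃ G : Matrix (Fin n) (Fin n) ℤ, G.det = 1 ∧ ∀ i j, inner ℝ (b i) (b j) = (G i j : ℝ) := by
  have := h.discrete
  have : IsZLattice ℝ Λ := ⟨h.spans⟩
  have hfin : Module.finrank ℤ Λ = n := by
    rw [ZLattice.rank ℝ Λ, finrank_euclideanSpace_fin]
  let b₀ : Basis (Fin n) ℤ Λ := Module.finBasisOfFinrankEq ℤ Λ hfin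
  let b := b₀.ofZLatticeBasis ℝ Λ
  have hb : ∀ i, b i = b₀ i := b₀.ofZLatticeBasis_apply ℝ Λ
  have hspan : Submodule.span ℤ (Set.range b) = Λ := b₀.ofZLatticeBasis_span ℝ Λ
  have hvol : volume (parallelepiped b) = 1 := by
    rw [← measure_congr (ZSpan.fundamentalDomain_ae_parallelepiped b volume)]
    have h1 := ZLattice.covolume_eq_measure_fundamentalDomain Λ volume
      (ZLattice.isAddFundamentalDomain b₀ volume)
    rw [h.covolume_eq_one, measureReal_def, eq_comm, ENNReal.toReal_eq_one_iff] at h1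
    exact h1
  refine ⟨b, hspan, (b.addHaar_eq_iff _).2 (by simpa using hvol), ?_⟩
  have hmem : ∀ i, b i ∈ Λ := fun i => hb i ▸ (b₀ i).2
  choose G hG using fun i j => h.integral (b i) (hmem i) (b j) (hmem j)
  refine ⟨Matrix.of G, ?_, hG⟩
  have h1 : Matrix.gram ℝ b = (Matrix.of G).map (Int.castRingHom ℝ) := by
    ext i j
    simpa [Matrix.gram_apply] using hG i j
  have h2 := ZLattice.covolume_eq_det_mul_measureReal Λ volume b₀
    (EuclideanSpace.basisFun (Fin n) ℝ).toBasis
  have h3 : volume.real (ZSpan.fundamentalDomain (EuclideanSpace.basisFun (Fin n) ℝ).toBasis) = 1 := by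
    rw [measureReal_def, measure_congr (ZSpan.fundamentalDomain_ae_parallelepiped _ volume)]
    simp [OrthonormalBasis.coe_toBasis, OrthonormalBasis.volume_parallelepiped]
  rw [h.covolume_eq_one, h3, mul_one] at h2
  have h4 := Matrix.gram_eq_conjTranspose_mul (EuclideanSpace.basisFun (Fin n) ℝ) b
  have h5 : (Matrix.gram ℝ b).det = 1 := by
    rw [h4, Matrix.det_mul, Matrix.det_conjTranspose]
    rw [Basis.det_apply] at h2
    have h6 : ((EuclideanSpace.basisFun (Fin n) ℝ).toBasis.toMatrix ((↑) ∘ b₀)) =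
      ((EuclideanSpace.basisFun (Fin n) ℝ).toBasis.toMatrix b) := by
      congr 1; ext1 i; exact (hb i).symm
    rw [h6] at h2
    simp only [star_trivial]
    rw [← abs_mul_abs_self]
    change |((EuclideanSpace.basisFun (Fin n) ℝ).toBasis.toMatrix b).det| *
      |((EuclideanSpace.basisFun (Fin n) ℝ).toBasis.toMatrix b).det| = 1
    rw [← h2, one_mul]
  rw [h1, ← RingHom.mapMatrix_apply, ← RingHom.map_det] at h5
  simpa using h5

/-- A unimodular lattice is equal to its dual. -/
theorem exists_coordinates (h : IsUnimodularLattice Λ) :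
    ∃ (e : (Fin n → ℤ) ≃ Λ) (e' : (Fin n → ℤ) ≃ Λ)
      (Φ : (Fin n → ℝ) ≃L[ℝ] EuclideanSpace ℝ (Fin n)),
      MeasurePreserving Φ ∧ (∀ l : Fin n → ℤ, (e l : EuclideanSpace ℝ (Fin n)) = Φ (fun i => l i)) ∧
      ∀ (m : Fin n → ℤ) (x : Fin n → ℝ),
        inner ℝ (e' m : EuclideanSpace ℝ (Fin n)) (Φ x) = ∑ i, (m i : ℝ) * x i := by
  obtain ⟨b, hspan, hvol, G, hdet, hG⟩ := h.exists_basis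
  let Φ : (Fin n → ℝ) ≃L[ℝ] EuclideanSpace ℝ (Fin n) := b.equivFunL.symm
  have hΦ : ∀ x, Φ x = ∑ i, x i • b i := fun x => b.equivFun_symm_apply x
  have hmp : MeasurePreserving Φ := by
    refine ⟨Φ.continuous.measurable, ?_⟩
    have h1 : (volume : Measure (Fin n → ℝ)) = (Pi.basisFun ℝ (Fin n)).addHaar := by
      rw [← addHaarMeasure_eq_volume_pi, ← Basis.parallelepiped_basisFun, ← Basis.addHaar]
    rw [h1, Basis.map_addHaar, ← hvol]
    congr 1
    ext1 i
    have := hΦ (Pi.single i 1)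
    simpa [Pi.single_apply] using this
  have hmem : ∀ x : EuclideanSpace ℝ (Fin n), x ∈ Λ ↔ ∃ l : Fin n → ℤ, Φ (fun i => l i) = x := by
    intro x
    rw [← hspan, Submodule.mem_span_range_iff_exists_fun]
    simp only [hΦ, Int.cast_smul_eq_zsmul]
  let e : (Fin n → ℤ) ≃ Λ := Equiv.ofBijective (fun l => ⟨Φ (fun i => l i), (hmem _).2 ⟨l, rfl⟩⟩) (by
    constructor
    · intro l m hlm
      have := Φ.injective (congrArg Subtype.val hlm)
      ext i
      exact_mod_cast congrFun this i
    · rintro ⟨x, hx⟩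
      obtain ⟨l, hl⟩ := (hmem x).1 hx
      exact ⟨l, Subtype.ext hl⟩)
  have hunit : IsUnit G.det := hdet ▸ isUnit_one
  -- An integral Gram matrix of determinant one has an integral inverse, so passing to coordinates
  -- in the dual basis only permutes `ℤⁿ`.
  let g : (Fin n → ℤ) ≃ (Fin n → ℤ) :=
    ⟨fun m => G⁻¹.mulVec m, fun m => G.mulVec m, fun m => by
      beta_reduce
      rw [Matrix.mulVec_mulVec, Matrix.mul_nonsing_inv _ hunit, Matrix.one_mulVec],
     fun m => by
      beta_reduce
      rw [Matrix.mulVec_mulVec, Matrix.nonsing_inv_mul _ hunit, Matrix.one_mulVec]⟩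
  refine ⟨e, g.trans e, Φ, hmp, fun _ => rfl, fun m x => ?_⟩
  have hGm : G.mulVec (g m) = m := g.symm_apply_apply m
  change inner ℝ (Φ fun i => (g m i : ℝ)) (Φ x) = _
  rw [hΦ, hΦ, inner_sum]
  refine Finset.sum_congr rfl fun j _ => ?_
  rw [inner_smul_right, sum_inner, mul_comm]
  congr 1
  conv_rhs => rw [← hGm]
  rw [Matrix.mulVec, dotProduct]
  push_cast
  refine Finset.sum_congr rfl fun i _ => ?_
  rw [inner_smul_left, real_inner_comm, hG]
  simp [mul_comm]

end IsUnimodularLattice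

end

/-! ### Gaussian sums over translates of a lattice. -/

section
open MeasureTheory Module Filter Topology

/-- A Gaussian is summable over every translate of a lattice, locally uniformly in the translate. -/
theorem exists_summable_gaussian_bound {n : ℕ} (Λ : Submodule ℤ (EuclideanSpace ℝ (Fin n)))
    [DiscreteTopology Λ] [IsZLattice ℝ Λ] {y : ℝ} (hy : 0 < y) (R : ℝ) :
    ∃ u : Λ → ℝ, Summable u ∧ ∀ a : EuclideanSpace ℝ (Fin n), ‖a‖ ≤ R → ∀ x : Λ,
      Real.exp (-Real.pi * y * ‖(x : EuclideanSpace ℝ (Fin n)) + a‖ ^ 2) ≤ u x := by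
  -- Half the decay rate is given up to absorb the translation by `a`. One term of the exponential
  -- series bounds the Gaussian by a multiple of `‖x‖ ^ (-2(n + 1))`, which is summable in rank `n`.
  have hs : Summable fun x : Λ => Real.exp (-(Real.pi * y / 2) * ‖(x : EuclideanSpace ℝ (Fin n))‖ ^ 2) := by
    have hc : 0 < Real.pi * y / 2 := by positivity
    have h0 := (ZLattice.summable_norm_pow_inv Λ (2 * (n + 1)) (by
      rw [ZLattice.rank ℝ Λ, finrank_euclideanSpace_fin]; omega)).mul_left
        (((n + 1).factorial : ℝ) / (Real.pi * y / 2) ^ (n + 1))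
    refine Summable.of_norm_bounded_eventually h0 ?_
    refine (Set.finite_singleton (0 : Λ)).subset fun x hx => ?_
    by_contra hx0
    refine hx ?_
    change ‖Real.exp _‖ ≤ _
    have hx1 : 0 < ‖(x : EuclideanSpace ℝ (Fin n))‖ := norm_pos_iff.2 (by simpa using hx0)
    rw [Real.norm_eq_abs, abs_of_pos (Real.exp_pos _), neg_mul, Real.exp_neg]
    have h1 := Real.pow_div_factorial_le_exp _
      (by positivity : 0 ≤ Real.pi * y / 2 * ‖(x : EuclideanSpace ℝ (Fin n))‖ ^ 2) (n + 1)
    refine (inv_anti₀ (by positivity) h1).trans (le_of_eq ?_)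
    rw [inv_div, mul_pow, ← pow_mul, inv_pow]
    simp only [Submodule.norm_coe]
    field_simp
  refine ⟨fun x => Real.exp (Real.pi * y * R ^ 2) *
    Real.exp (-(Real.pi * y / 2) * ‖(x : EuclideanSpace ℝ (Fin n))‖ ^ 2), hs.mul_left _,
    fun a ha x => ?_⟩
  beta_reduce
  rw [← Real.exp_add]
  refine Real.exp_le_exp.2 ?_
  have h1 : ‖(x : EuclideanSpace ℝ (Fin n))‖ ^ 2 ≤
      2 * ‖(x : EuclideanSpace ℝ (Fin n)) + a‖ ^ 2 + 2 * R ^ 2 := by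
    have h2 : ‖(x : EuclideanSpace ℝ (Fin n))‖ ≤ ‖(x : EuclideanSpace ℝ (Fin n)) + a‖ + R := by
      have := norm_sub_le ((x : EuclideanSpace ℝ (Fin n)) + a) a
      rw [add_sub_cancel_right] at this
      linarith
    nlinarith [sq_nonneg (‖(x : EuclideanSpace ℝ (Fin n)) + a‖ - R),
      norm_nonneg (x : EuclideanSpace ℝ (Fin n))]
  have : 0 < Real.pi * y := by positivity
  nlinarith

/-- The theta function of the translate `Λ + a` of a lattice. -/
noncomputable def shiftedTheta {n : ℕ} (Λ : Submodule ℤ (EuclideanSpace ℝ (Fin n)))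
    (a : EuclideanSpace ℝ (Fin n)) (z : ℂ) : ℂ :=
  ∑' x : Λ, Complex.exp (Real.pi * Complex.I * ((‖(x : EuclideanSpace ℝ (Fin n)) + a‖ ^ 2 : ℝ) : ℂ) * z)

theorem norm_cexp_pi_I_mul (t : ℝ) (z : ℂ) :
    ‖Complex.exp (Real.pi * Complex.I * (t : ℂ) * z)‖ = Real.exp (-Real.pi * z.im * t) := by
  rw [Complex.norm_exp]
  congr 1
  simp [Complex.mul_re, Complex.mul_im]
  ring

namespace IsUnimodularLattice

variable {n : ℕ} {Λ : Submodule ℤ (EuclideanSpace ℝ (Fin n))}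

theorem summable_gaussian (h : IsUnimodularLattice Λ) {y : ℝ} (hy : 0 < y)
    (a : EuclideanSpace ℝ (Fin n)) :
    Summable fun x : Λ => Real.exp (-Real.pi * y * ‖(x : EuclideanSpace ℝ (Fin n)) + a‖ ^ 2) := by
  have := h.discrete
  have : IsZLattice ℝ Λ := ⟨h.spans⟩
  obtain ⟨u, hu, hb⟩ := exists_summable_gaussian_bound Λ hy ‖a‖
  exact hu.of_nonneg_of_le (fun x => (Real.exp_pos _).le) (hb a le_rfl)

/-- The transformation formula of theta functions of translates under `z ↦ -1 / z`. -/
theorem shiftedTheta_eq (h : IsUnimodularLattice Λ) (a : EuclideanSpace ℝ (Fin n)) {z : ℂ}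
    (hz : 0 < z.im) :
    ((-Complex.I * z) ^ (1 / 2 : ℂ)) ^ n * shiftedTheta Λ a z =
      ∑' x : Λ, Complex.exp (2 * Real.pi * Complex.I * ((inner ℝ (x : EuclideanSpace ℝ (Fin n)) a : ℝ) : ℂ)) *
        Complex.exp (Real.pi * Complex.I * ((‖(x : EuclideanSpace ℝ (Fin n))‖ ^ 2 : ℝ) : ℂ) * (-1 / z)) := by
  have := h.discrete
  have : IsZLattice ℝ Λ := ⟨h.spans⟩
  obtain ⟨e, e', Φ, hmp, he, he'⟩ := h.exists_coordinates
  have hz0 : z ≠ 0 := by rintro rfl; simp at hz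
  set b : ℂ := Real.pi * (-Complex.I * z) with hb
  have hbre : 0 < b.re := by
    rw [hb, Complex.re_ofReal_mul]
    have : (-Complex.I * z).re = z.im := by simp
    rw [this]; positivity
  set g : EuclideanSpace ℝ (Fin n) → ℂ := fun v => Complex.exp (-b * ‖v‖ ^ 2) with hg
  have hgeq : ∀ v, g v = Complex.exp (Real.pi * Complex.I * ((‖v‖ ^ 2 : ℝ) : ℂ) * z) := by
    intro v
    simp only [hg, hb]
    congr 1
    push_cast
    ring
  have hgn : ∀ v, ‖g v‖ = Real.exp (-Real.pi * z.im * ‖v‖ ^ 2) := by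
    intro v
    rw [hgeq, norm_cexp_pi_I_mul]
  have hgi : Integrable g := by
    simpa [hg] using GaussianFourier.integrable_cexp_neg_mul_sq_norm_add hbre 0 (0 : EuclideanSpace ℝ (Fin n))
  have hgc : Continuous g := by fun_prop
  set r : ℂ := (-Complex.I * z) ^ (1 / 2 : ℂ) with hr
  have hr0 : r ≠ 0 := by
    rw [hr, Ne, Complex.cpow_eq_zero_iff]
    simp [hz0]
  have hπb : (Real.pi : ℂ) / b = (-Complex.I * z)⁻¹ := by
    rw [hb]
    have : (Real.pi : ℂ) ≠ 0 := by exact_mod_cast Real.pi_ne_zero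
    field_simp
  -- The Gaussian is its own Fourier transform up to `z ↦ -1 / z` and the automorphy factor. The
  -- branch of the root is harmless because `-i z` has positive real part.
  have hfour : ∀ w, FourierTransform.fourier g w = (r ^ n)⁻¹ *
      Complex.exp (Real.pi * Complex.I * ((‖w‖ ^ 2 : ℝ) : ℂ) * (-1 / z)) := by
    intro w
    rw [hg, fourier_gaussian_innerProductSpace hbre w, hπb, finrank_euclideanSpace_fin]
    congr 1
    · rw [Complex.inv_cpow _ _ (by
        intro h'
        rw [Complex.arg_eq_pi_iff] at h'
        have : (-Complex.I * z).re = z.im := by simp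
        linarith [h'.1]), hr, ← Complex.cpow_nat_mul]
      congr 2
      ring
    · congr 1
      rw [hb]
      have : (Real.pi : ℂ) ≠ 0 := by exact_mod_cast Real.pi_ne_zero
      push_cast
      field_simp
      linear_combination ((‖w‖ : ℂ) ^ 2) * Complex.I_sq
  -- Poisson summation in lattice coordinates: `e` indexes the translates and `e'` the frequencies,
  -- which by self-duality run over `Λ` again.
  have key := hasSum_poisson_pi (f := fun x => g (Φ x)) (hgc.comp Φ.continuous)
    (hmp.integrable_comp_of_integrable hgi) (by
      intro R
      obtain ⟨u, hu, hbd⟩ := exists_summable_gaussian_bound Λ hz (‖(Φ : (Fin n → ℝ) →L[ℝ] EuclideanSpace ℝ (Fin n))‖ * R)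
      refine ⟨fun l => u (e l), e.summable_iff.2 hu, fun x hx l => ?_⟩
      rw [hgn, map_add, ← he, add_comm]
      refine hbd _ ?_ _
      exact ((Φ : (Fin n → ℝ) →L[ℝ] EuclideanSpace ℝ (Fin n)).le_opNorm x).trans (by gcongr))
    (c := fun m => (r ^ n)⁻¹ * Complex.exp (Real.pi * Complex.I *
      ((‖(e' m : EuclideanSpace ℝ (Fin n))‖ ^ 2 : ℝ) : ℂ) * (-1 / z))) (by
      intro m
      rw [← hfour, Real.fourier_eq', ← hmp.integral_comp Φ.toHomeomorph.measurableEmbedding]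
      refine integral_congr_ae (Eventually.of_forall fun x => ?_)
      simp only [smul_eq_mul]
      rw [real_inner_comm, he']
      congr 2
      push_cast
      ring) (by
      refine Summable.mul_left _ (.of_norm ?_)
      have hz' : 0 < (-1 / z).im := by
        rw [show -1 / z = -z⁻¹ by ring, Complex.neg_im, Complex.inv_im]
        have := Complex.normSq_pos.2 hz0
        rw [neg_div, neg_neg]; positivity
      have := e'.summable_iff.2 (h.summable_gaussian hz' 0)
      refine this.congr fun m => ?_
      rw [norm_cexp_pi_I_mul]
      simp) (Φ.symm a)
  have h1 : ∑' l : Fin n → ℤ, g (Φ (Φ.symm a + fun i => (l i : ℝ))) = shiftedTheta Λ a z := by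
    rw [shiftedTheta, ← e.tsum_eq]
    refine tsum_congr fun l => ?_
    rw [hgeq, map_add, he, Φ.apply_symm_apply, add_comm]
  rw [h1] at key
  rw [← key.tsum_eq, ← tsum_mul_left, ← e'.tsum_eq]
  refine tsum_congr fun m => ?_
  have h2 := he' m (Φ.symm a)
  rw [Φ.apply_symm_apply] at h2
  rw [h2]
  push_cast
  field_simp

/-- Modulo `2` the map `v ↦ (v, v)` is additive, because the cross term is `2 (u, v)`. By
self-duality some `w ∈ Λ` satisfies `(w, bᵢ) = (bᵢ, bᵢ)` on a basis, and the congruence then spreads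
to all of `Λ`. -/
theorem exists_isCharacteristicVector (h : IsUnimodularLattice Λ) :
    ∃ w, IsCharacteristicVector Λ w := by
  obtain ⟨e, e', Φ, hmp, he, he'⟩ := h.exists_coordinates
  have hmem : ∀ i, (e (Pi.single i 1) : EuclideanSpace ℝ (Fin n)) ∈ Λ := fun i => (e _).2
  choose N hN using fun i => h.integral _ (hmem i) _ (hmem i)
  set w : EuclideanSpace ℝ (Fin n) := (e' N : Λ).1 with hw
  have hwΛ : w ∈ Λ := (e' N).2
  refine ⟨w, hwΛ, ?_⟩
  have hb : ∀ i, inner ℝ w (e (Pi.single i 1) : EuclideanSpace ℝ (Fin n)) = (N i : ℝ) := by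
    intro i
    rw [he, hw, he']
    simp [Pi.single_apply]
  have hadd : ∀ u ∈ Λ, ∀ v ∈ Λ, (∃ m : ℤ, inner ℝ w u - inner ℝ u u = 2 * (m : ℝ)) →
      (∃ m : ℤ, inner ℝ w v - inner ℝ v v = 2 * (m : ℝ)) →
      ∃ m : ℤ, inner ℝ w (u + v) - inner ℝ (u + v) (u + v) = 2 * (m : ℝ) := by
    rintro u hu v hv ⟨m, hm⟩ ⟨m', hm'⟩
    obtain ⟨c, hc⟩ := h.integral u hu v hv
    refine ⟨m + m' - c, ?_⟩
    rw [real_inner_add_add_self, inner_add_right, hc]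
    push_cast
    linarith
  have hneg : ∀ u ∈ Λ, (∃ m : ℤ, inner ℝ w u - inner ℝ u u = 2 * (m : ℝ)) →
      ∃ m : ℤ, inner ℝ w (-u) - inner ℝ (-u) (-u) = 2 * (m : ℝ) := by
    rintro u hu ⟨m, hm⟩
    obtain ⟨c, hc⟩ := h.integral w hwΛ u hu
    refine ⟨m - c, ?_⟩
    rw [inner_neg_neg, inner_neg_right]
    push_cast
    linarith
  have hspan : ∀ v ∈ Λ, v ∈ Submodule.span ℤ
      (Set.range fun i => (e (Pi.single i 1) : EuclideanSpace ℝ (Fin n))) := by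
    intro v hv
    obtain ⟨l, hl⟩ := e.surjective ⟨v, hv⟩
    rw [Submodule.mem_span_range_iff_exists_fun]
    refine ⟨l, ?_⟩
    have : v = Φ (fun i => (l i : ℝ)) := by rw [← he, hl]
    rw [this]
    have h2 : (fun i => (l i : ℝ)) = ∑ i, l i • (fun j => ((Pi.single i 1 : Fin n → ℤ) j : ℝ)) := by
      ext j
      simp [Finset.sum_apply, Pi.single_apply]
    rw [h2, map_sum]
    refine Finset.sum_congr rfl fun i _ => ?_
    rw [he, map_zsmul]
  intro v hv
  have hle : Submodule.span ℤ (Set.range fun i => (e (Pi.single i 1) : EuclideanSpace ℝ (Fin n))) ≤ Λ :=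
    Submodule.span_le.2 (by rintro _ ⟨i, rfl⟩; exact hmem i)
  let S : AddSubgroup (EuclideanSpace ℝ (Fin n)) :=
    { carrier := {v | v ∈ Λ ∧ ∃ m : ℤ, inner ℝ w v - inner ℝ v v = 2 * (m : ℝ)}
      zero_mem' := ⟨Λ.zero_mem, 0, by simp⟩
      add_mem' := fun {u v} hu hv => ⟨Λ.add_mem hu.1 hv.1, hadd u hu.1 v hv.1 hu.2 hv.2⟩
      neg_mem' := fun {u} hu => ⟨Λ.neg_mem hu.1, hneg u hu.1 hu.2⟩ }
  have : Submodule.span ℤ (Set.range fun i => (e (Pi.single i 1) : EuclideanSpace ℝ (Fin n))) ≤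
      AddSubgroup.toIntSubmodule S := by
    refine Submodule.span_le.2 ?_
    rintro _ ⟨i, rfl⟩
    exact ⟨hmem i, 0, by rw [hb, hN]; simp⟩
  exact (this (hspan v hv)).2

end IsUnimodularLattice

end

section
-- Level one modular forms.
section LevelOne
open Complex Filter Topology UpperHalfPlane ModularForm MatrixGroups Asymptotics

theorem discriminant_add_one (τ : ℍ) : discriminant ((1 : ℝ) +ᵥ τ) = discriminant τ := by
  have := congrFun discriminant_T_invariant τ
  rw [SL_slash_apply, modular_T_smul] at this
  have h1 : denom (Matrix.SpecialLinearGroup.toGL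
      ((Matrix.SpecialLinearGroup.map (Int.castRingHom ℝ)) ModularGroup.T)) (τ : ℂ) = 1 := by
    rw [ModularGroup.denom_apply]
    simp [ModularGroup.T]
  rw [h1, one_zpow, mul_one] at this
  exact this

theorem discriminant_S_smul (τ : ℍ) :
    discriminant (ModularGroup.S • τ) = (τ : ℂ) ^ 12 * discriminant τ := by
  have := congrFun discriminant_S_invariant τ
  rw [SL_slash_apply, ModularGroup.denom_S] at this
  rw [← this, zpow_neg, mul_comm, mul_assoc]
  have h1 : ((τ : ℂ) ^ (12 : ℤ)) = (τ : ℂ) ^ 12 := zpow_ofNat _ _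
  rw [h1, inv_mul_cancel₀ (pow_ne_zero 12 τ.ne_zero), mul_one]

/-- A form of weight `12 n` and level one that decays faster than `Δ ^ n` vanishes. -/
theorem eq_zero_of_levelOne_of_decay {n : ℕ} {f : ℂ → ℂ}
    (hf : DifferentiableOn ℂ f {z | 0 < z.im})
    (hT : ∀ z : ℂ, 0 < z.im → f (z + 1) = f z)
    (hS : ∀ z : ℂ, 0 < z.im → f (-1 / z) = z ^ (12 * n) * f z)
    {K y₀ : ℝ} (hK : ∀ z : ℂ, y₀ ≤ z.im → ‖f z‖ ≤ K * Real.exp (-2 * Real.pi * z.im) ^ (n + 1))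
    {z : ℂ} (hz : 0 < z.im) : f z = 0 := by
  -- `Δ` has no zeros on the upper half-plane, so the quotient is holomorphic of weight zero. The
  -- extra decay makes it vanish at `i∞`, and level one forms of weight zero are constant.
  set g : ℍ → ℂ := fun τ => f τ / discriminant τ ^ n with hg
  have hgS : g ∣[(0 : ℤ)] ModularGroup.S = g := by
    ext τ
    rw [SL_slash_apply, neg_zero, zpow_zero, mul_one]
    simp only [hg]
    rw [discriminant_S_smul, modular_S_smul]
    have h1 : f (-(τ : ℂ))⁻¹ = (τ : ℂ) ^ (12 * n) * f τ := by
      rw [← hS τ τ.2]; congr 1; rw [neg_div, one_div, inv_neg]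
    rw [UpperHalfPlane.coe_mk, h1, mul_pow, ← pow_mul,
      mul_div_mul_left _ _ (pow_ne_zero _ τ.ne_zero)]
  have hgT : g ∣[(0 : ℤ)] ModularGroup.T = g := by
    ext τ
    rw [SL_slash_apply, neg_zero, zpow_zero, mul_one]
    simp only [hg]
    rw [modular_T_smul, discriminant_add_one, UpperHalfPlane.coe_vadd, ofReal_one, add_comm (1 : ℂ),
      hT τ τ.2]
  have hslash := SlashInvariantForm.slash_action_generators_SL2Z hgS hgT
  have hdec : (fun τ : ℍ => g τ) =O[atImInfty] fun τ : ℍ => Real.exp (-2 * Real.pi * τ.im) := by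
    have h1 : (fun τ : ℍ => f τ) =O[atImInfty]
        fun τ : ℍ => Real.exp (-2 * Real.pi * τ.im) ^ (n + 1) := by
      refine IsBigO.of_bound K ?_
      rw [Filter.Eventually, atImInfty_mem]
      refine ⟨y₀, fun τ hτ => ?_⟩
      refine (hK τ hτ).trans (le_of_eq ?_)
      rw [Real.norm_of_nonneg (by positivity)]
      rfl
    have h2 : (fun τ : ℍ => (discriminant τ ^ n)⁻¹) =O[atImInfty]
        fun τ : ℍ => (Real.exp (-2 * Real.pi * τ.im) ^ n)⁻¹ := by
      refine (exp_isBigO_discriminant.pow n).inv_rev ?_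
      exact Eventually.of_forall fun τ h => absurd h (pow_pos (Real.exp_pos _) n).ne'
    refine (h1.mul h2).congr (fun τ => (div_eq_mul_inv _ _).symm) fun τ => ?_
    rw [pow_succ, mul_comm, ← mul_assoc, inv_mul_cancel₀ (pow_pos (Real.exp_pos _) n).ne', one_mul]
  have hexp0 : Tendsto (fun τ : ℍ => Real.exp (-2 * Real.pi * τ.im)) atImInfty (𝓝 0) := by
    have h1 : Tendsto (fun τ : ℍ => τ.im) atImInfty atTop := tendsto_comap
    exact Real.tendsto_exp_atBot.comp (h1.const_mul_atTop_of_neg (by linarith [Real.pi_pos]))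
  have hg0 : Tendsto g atImInfty (𝓝 0) := hdec.trans_tendsto hexp0
  let M : ModularForm 𝒮ℒ 0 :=
    { toFun := g
      slash_action_eq' := by rintro _ ⟨γ, rfl⟩; exact hslash γ
      holo' := by
        have hfm : DifferentiableOn ℂ ((fun τ : ℍ => f τ) ∘ ofComplex) {z | 0 < z.im} :=
          hf.congr fun z hz => by simp [Function.comp, ofComplex_apply_of_im_pos hz]
        have hd := UpperHalfPlane.mdifferentiable_iff.1 CuspForm.discriminant.holo'
        rw [UpperHalfPlane.mdifferentiable_iff]
        refine (hfm.div (hd.pow n) fun z hz => pow_ne_zero _ (discriminant_ne_zero _)).congr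
          fun z hz => ?_
        rfl
      bdd_at_cusps' := fun {c} hc => by
        rw [Subgroup.IsArithmetic.isCusp_iff_isCusp_SL2Z] at hc
        rw [OnePoint.isBoundedAt_iff_forall_SL2Z hc]
        intro γ _
        rw [hslash γ]
        exact hg0.isBigO_one ℝ }
  obtain ⟨c, hc⟩ := ModularFormClass.levelOne_weight_zero_const M
  have hgc : ∀ τ, g τ = c := fun τ => congrFun hc τ
  have hc0 : c = 0 := by
    have h1 : Tendsto g atImInfty (𝓝 c) := by
      simp only [funext hgc]; exact tendsto_const_nhds
    exact tendsto_nhds_unique h1 hg0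
  have h2 := hgc ⟨z, hz⟩
  rw [hc0] at h2
  simpa [hg, discriminant_ne_zero] using h2

end LevelOne

/-! ### Triples transforming like powers of the Jacobi theta functions. -/

/-- The factor of automorphy of weight one half, for `z ↦ -1 / z`. -/
noncomputable def thetaFactor (z : ℂ) : ℂ := (-Complex.I * z) ^ (1 / 2 : ℂ)

theorem im_neg_one_div_pos {z : ℂ} (hz : 0 < z.im) : 0 < (-1 / z).im := by
  have hz0 : z ≠ 0 := by rintro rfl; simp at hz
  rw [show -1 / z = -z⁻¹ by ring, Complex.neg_im, Complex.inv_im, neg_div, neg_neg]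
  have := Complex.normSq_pos.2 hz0
  positivity

theorem thetaFactor_pow_eight (z : ℂ) : thetaFactor z ^ 8 = z ^ 4 := by
  have : thetaFactor z ^ 2 = -Complex.I * z := by
    rw [thetaFactor, ← Complex.cpow_nat_mul]; norm_num
  rw [show 8 = 2 * 4 by rfl, pow_mul, this, mul_pow, neg_pow, Complex.I_pow_four]
  norm_num

theorem thetaFactor_mul_thetaFactor {z : ℂ} (hz : 0 < z.im) :
    thetaFactor (-1 / z) * thetaFactor z = 1 := by
  have hz0 : z ≠ 0 := by rintro rfl; simp at hz
  have h1 : -Complex.I * (-1 / z) = (-Complex.I * z)⁻¹ := by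
    field_simp
    simp
  have h2 : (-Complex.I * z) ≠ 0 := by simp [hz0]
  rw [thetaFactor, thetaFactor, h1, Complex.inv_cpow, inv_mul_cancel₀]
  · rw [Ne, Complex.cpow_eq_zero_iff]; simp [hz0]
  · intro h'
    rw [Complex.arg_eq_pi_iff] at h'
    have : (-Complex.I * z).re = z.im := by simp
    linarith [h'.1]

/-- Three holomorphic functions on the upper half-plane that are permuted by `z ↦ z + 1` and
`z ↦ -1 / z` in the same way as the `n`-th powers of the Jacobi theta functions `θ₃, θ₄, θ₂`. -/
structure IsThetaTriple (n : ℕ) (A B C : ℂ → ℂ) : Prop where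
  diffA : DifferentiableOn ℂ A {z | 0 < z.im}
  diffB : DifferentiableOn ℂ B {z | 0 < z.im}
  diffC : DifferentiableOn ℂ C {z | 0 < z.im}
  A_add : ∀ z : ℂ, 0 < z.im → A (z + 1) = B z
  B_add : ∀ z : ℂ, 0 < z.im → B (z + 1) = A z
  C_add : ∀ z : ℂ, 0 < z.im → C (z + 1) = Complex.exp (Real.pi * Complex.I / 4) ^ n * C z
  A_inv : ∀ z : ℂ, 0 < z.im → A (-1 / z) = thetaFactor z ^ n * A z
  B_inv : ∀ z : ℂ, 0 < z.im → B (-1 / z) = thetaFactor z ^ n * C z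
  C_inv : ∀ z : ℂ, 0 < z.im → C (-1 / z) = thetaFactor z ^ n * B z

/-- Apply the hypothesis at `-1 / z`: the inversion is an involution and the factors at `z` and `-1
/ z` are reciprocal. Hence only one of `B_inv`, `C_inv` has to be proved for each triple. -/
theorem inv_formula_symm {n : ℕ} {B C : ℂ → ℂ}
    (h : ∀ z : ℂ, 0 < z.im → B (-1 / z) = thetaFactor z ^ n * C z) {z : ℂ} (hz : 0 < z.im) :
    C (-1 / z) = thetaFactor z ^ n * B z := by
  have hz0 : z ≠ 0 := by rintro rfl; simp at hz
  have h1 := h (-1 / z) (im_neg_one_div_pos hz)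
  rw [show -1 / (-1 / z) = z by field_simp] at h1
  rw [h1, ← mul_assoc, ← mul_pow, mul_comm (thetaFactor z), thetaFactor_mul_thetaFactor hz, one_pow,
    one_mul]

namespace IsThetaTriple

variable {n m : ℕ} {A B C A' B' C' : ℂ → ℂ}

theorem mul (h : IsThetaTriple n A B C) (h' : IsThetaTriple m A' B' C') :
    IsThetaTriple (n + m) (A * A') (B * B') (C * C') where
  diffA := h.diffA.mul h'.diffA
  diffB := h.diffB.mul h'.diffB
  diffC := h.diffC.mul h'.diffC
  A_add z hz := by simp [h.A_add z hz, h'.A_add z hz]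
  B_add z hz := by simp [h.B_add z hz, h'.B_add z hz]
  C_add z hz := by simp only [Pi.mul_apply, h.C_add z hz, h'.C_add z hz]; ring
  A_inv z hz := by simp only [Pi.mul_apply, h.A_inv z hz, h'.A_inv z hz]; ring
  B_inv z hz := by simp only [Pi.mul_apply, h.B_inv z hz, h'.B_inv z hz]; ring
  C_inv z hz := by simp only [Pi.mul_apply, h.C_inv z hz, h'.C_inv z hz]; ring

theorem pow (h : IsThetaTriple n A B C) (j : ℕ) :
    IsThetaTriple (n * j) (A ^ j) (B ^ j) (C ^ j) := by
  induction j with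
  | zero =>
    constructor <;> first | exact differentiableOn_const _ | simp
  | succ j ih => simpa only [pow_succ, mul_add, mul_one] using ih.mul h

theorem sub (h : IsThetaTriple n A B C) (h' : IsThetaTriple n A' B' C') :
    IsThetaTriple n (A - A') (B - B') (C - C') where
  diffA := h.diffA.sub h'.diffA
  diffB := h.diffB.sub h'.diffB
  diffC := h.diffC.sub h'.diffC
  A_add z hz := by simp [h.A_add z hz, h'.A_add z hz]
  B_add z hz := by simp [h.B_add z hz, h'.B_add z hz]
  C_add z hz := by simp only [Pi.sub_apply, h.C_add z hz, h'.C_add z hz]; ring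
  A_inv z hz := by simp only [Pi.sub_apply, h.A_inv z hz, h'.A_inv z hz]; ring
  B_inv z hz := by simp only [Pi.sub_apply, h.B_inv z hz, h'.B_inv z hz]; ring
  C_inv z hz := by simp only [Pi.sub_apply, h.C_inv z hz, h'.C_inv z hz]; ring

theorem sum {ι : Type*} (s : Finset ι) {F G H : ι → ℂ → ℂ} (c : ι → ℂ)
    (h : ∀ i ∈ s, IsThetaTriple n (F i) (G i) (H i)) :
    IsThetaTriple n (fun z => ∑ i ∈ s, c i * F i z) (fun z => ∑ i ∈ s, c i * G i z)
      (fun z => ∑ i ∈ s, c i * H i z) where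
  diffA := .fun_sum fun i hi => (h i hi).diffA.const_mul _
  diffB := .fun_sum fun i hi => (h i hi).diffB.const_mul _
  diffC := .fun_sum fun i hi => (h i hi).diffC.const_mul _
  A_add z hz := Finset.sum_congr rfl fun i hi => by rw [(h i hi).A_add z hz]
  B_add z hz := Finset.sum_congr rfl fun i hi => by rw [(h i hi).B_add z hz]
  C_add z hz := by
    rw [Finset.mul_sum]
    exact Finset.sum_congr rfl fun i hi => by rw [(h i hi).C_add z hz]; ring
  A_inv z hz := by
    rw [Finset.mul_sum]
    exact Finset.sum_congr rfl fun i hi => by rw [(h i hi).A_inv z hz]; ring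
  B_inv z hz := by
    rw [Finset.mul_sum]
    exact Finset.sum_congr rfl fun i hi => by rw [(h i hi).B_inv z hz]; ring
  C_inv z hz := by
    rw [Finset.mul_sum]
    exact Finset.sum_congr rfl fun i hi => by rw [(h i hi).C_inv z hz]; ring

/-- A theta triple whose third component vanishes to high order at `i∞` is zero. -/
theorem eq_zero_of_decay (h : IsThetaTriple n A B C) {K y₀ : ℝ} (hy₀ : 0 < y₀)
    (hA : ∀ z : ℂ, y₀ ≤ z.im → ‖A z‖ ≤ K) (hB : ∀ z : ℂ, y₀ ≤ z.im → ‖B z‖ ≤ K)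
    (hC : ∀ z : ℂ, y₀ ≤ z.im → ‖C z‖ ≤ K * Real.exp (-Real.pi * z.im * (n / 4 + 2)))
    {z : ℂ} (hz : 0 < z.im) : A z = 0 := by
  -- The generators permute `A`, `B`, `C` up to factors. The eighth power removes the root of unity
  -- from `C_add` and turns the weight `3n / 2` of the product into `12 n`.
  set F : ℂ → ℂ := fun z => (A z * B z * C z) ^ 8 with hF
  have hadd1 : ∀ z : ℂ, 0 < z.im → 0 < (z + 1).im := fun z hz => by simpa using hz
  have hF0 : ∀ z : ℂ, 0 < z.im → F z = 0 := fun z hz => by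
    refine eq_zero_of_levelOne_of_decay (n := n) (f := F) (K := K ^ 24) (y₀ := y₀)
      (((h.diffA.mul h.diffB).mul h.diffC).pow 8) (fun z hz => ?_) (fun z hz => ?_)
      (fun z hz => ?_) hz
    · simp only [hF]
      rw [h.A_add z hz, h.B_add z hz, h.C_add z hz]
      have : (Complex.exp (Real.pi * Complex.I / 4) ^ n) ^ 8 = 1 := by
        rw [← pow_mul, mul_comm n, pow_mul, ← Complex.exp_nat_mul]
        rw [show ((8 : ℕ) : ℂ) * (Real.pi * Complex.I / 4) = 2 * Real.pi * Complex.I by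
          push_cast; ring, Complex.exp_two_pi_mul_I, one_pow]
      linear_combination (B z * A z * C z) ^ 8 * this
    · simp only [hF]
      rw [h.A_inv z hz, h.B_inv z hz, h.C_inv z hz]
      have : z ^ (12 * n) = (thetaFactor z ^ 8) ^ (3 * n) := by
        rw [thetaFactor_pow_eight, ← pow_mul]; ring_nf
      rw [this]
      ring
    · have hK : 0 ≤ K := (norm_nonneg _).trans (hA z hz)
      simp only [hF]
      rw [norm_pow, norm_mul, norm_mul]
      have h1 : ‖A z‖ * ‖B z‖ * ‖C z‖ ≤
          K * K * (K * Real.exp (-Real.pi * z.im * (n / 4 + 2))) := by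
        gcongr
        exacts [hA z hz, hB z hz, hC z hz]
      refine (pow_le_pow_left₀ (by positivity) h1 8).trans ?_
      have h2 : Real.exp (-Real.pi * z.im * (n / 4 + 2)) ^ 8 ≤
          Real.exp (-2 * Real.pi * z.im) ^ (n + 1) := by
        rw [← Real.exp_nat_mul, ← Real.exp_nat_mul, Real.exp_le_exp]
        push_cast
        nlinarith [mul_pos Real.pi_pos (hy₀.trans_le hz)]
      calc (K * K * (K * Real.exp (-Real.pi * z.im * (n / 4 + 2)))) ^ 8
          = K ^ 24 * Real.exp (-Real.pi * z.im * (n / 4 + 2)) ^ 8 := by ring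
        _ ≤ _ := by gcongr
  have hprod : ∀ z : ℂ, 0 < z.im → A z * B z * C z = 0 := fun z hz => by
    simpa [hF] using hF0 z hz
  -- By the identity theorem one of the three factors vanishes identically. The transformation laws
  -- carry this vanishing back to `A`.
  have hopen : IsOpen {z : ℂ | 0 < z.im} := isOpen_lt continuous_const Complex.continuous_im
  have hconn : IsPreconnected {z : ℂ | 0 < z.im} := (convex_halfSpace_im_gt 0).isPreconnected
  have han : ∀ {f : ℂ → ℂ}, DifferentiableOn ℂ f {z | 0 < z.im} →
      AnalyticOnNhd ℂ f {z | 0 < z.im} := fun hf => hf.analyticOnNhd hopen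
  have hBA : (∀ z : ℂ, 0 < z.im → B z = 0) → ∀ z : ℂ, 0 < z.im → A z = 0 := fun hB z hz => by
    rw [← h.B_add z hz]; exact hB _ (hadd1 z hz)
  have hCB : (∀ z : ℂ, 0 < z.im → C z = 0) → ∀ z : ℂ, 0 < z.im → B z = 0 := fun hC z hz => by
    have hz0 : z ≠ 0 := by rintro rfl; simp at hz
    have h1 := h.B_inv _ (im_neg_one_div_pos hz)
    rwa [hC _ (im_neg_one_div_pos hz), mul_zero, show -1 / (-1 / z) = z by field_simp] at h1
  rcases (han (h.diffA.mul h.diffB)).eq_zero_or_eq_zero_of_mul_eq_zero (han h.diffC)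
    (fun z hz => hprod z hz) hconn with h1 | h1
  · rcases (han h.diffA).eq_zero_or_eq_zero_of_mul_eq_zero (han h.diffB)
      (fun z hz => h1 z hz) hconn with h2 | h2
    · exact h2 z hz
    · exact hBA h2 z hz
  · exact hBA (hCB h1) z hz

end IsThetaTriple

end

section
open Complex Filter Topology

/-! ### The Jacobi theta functions -/

/-- The Jacobi theta function `θ₂`. -/
noncomputable def jacobiThetaTwo (z : ℂ) : ℂ := exp (Real.pi * I * z / 4) * jacobiTheta₂ (z / 2) z

/-- The Jacobi theta function `θ₃`. -/
noncomputable def jacobiThetaThree (z : ℂ) : ℂ := jacobiTheta₂ 0 z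

/-- The Jacobi theta function `θ₄`. -/
noncomputable def jacobiThetaFour (z : ℂ) : ℂ := jacobiTheta₂ (1 / 2) z

/-- Since `m² ≡ m (mod 2)`, the sign `exp (π i m²)` equals `exp (π i m)`. -/
theorem jacobiTheta₂_add_one (u z : ℂ) : jacobiTheta₂ u (z + 1) = jacobiTheta₂ (u + 1 / 2) z := by
  refine tsum_congr fun m => ?_
  rw [jacobiTheta₂_term, jacobiTheta₂_term]
  obtain ⟨c, hc⟩ : ∃ c : ℤ, (m : ℂ) ^ 2 = m + 2 * c := by
    obtain ⟨c, hc⟩ := Int.even_mul_pred_self m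
    refine ⟨c, ?_⟩
    have h1 : m ^ 2 = m + 2 * c := by linarith [hc, sq m, mul_sub m m 1]
    exact_mod_cast h1
  refine exp_eq_exp_iff_exists_int.2 ⟨c, ?_⟩
  linear_combination Real.pi * I * hc

theorem jacobiTheta₂_functional_equation' (u : ℂ) {z : ℂ} (hz : 0 < z.im) :
    jacobiTheta₂ (u / z) (-1 / z) = thetaFactor z * exp (Real.pi * I * u ^ 2 / z) * jacobiTheta₂ u z := by
  have hz0 : z ≠ 0 := by rintro rfl; simp at hz
  have hr : thetaFactor z ≠ 0 := by
    rw [thetaFactor, Ne, cpow_eq_zero_iff]; simp [hz0]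
  rw [jacobiTheta₂_functional_equation u z]
  have h1 : exp (Real.pi * I * u ^ 2 / z) * exp (-Real.pi * I * u ^ 2 / z) = 1 := by
    rw [← exp_add, show Real.pi * I * u ^ 2 / z + -Real.pi * I * u ^ 2 / z = 0 by ring, exp_zero]
  have h2 : thetaFactor z * (1 / (-I * z) ^ (1 / 2 : ℂ)) = 1 := by
    rw [← thetaFactor, mul_one_div_cancel hr]
  linear_combination (-jacobiTheta₂ (u / z) (-1 / z)) * h1 * (thetaFactor z * (1 / (-I * z) ^ (1 / 2 : ℂ))) -
    jacobiTheta₂ (u / z) (-1 / z) * h2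

theorem differentiableOn_jacobiTheta₂ (u : ℂ) :
    DifferentiableOn ℂ (jacobiTheta₂ u) {z | 0 < z.im} := fun _ hz =>
  (differentiableAt_jacobiTheta₂_snd u hz).differentiableWithinAt

theorem isThetaTriple_jacobi :
    IsThetaTriple 1 jacobiThetaThree jacobiThetaFour jacobiThetaTwo := by
  have hB : ∀ z : ℂ, 0 < z.im → jacobiThetaFour (-1 / z) = thetaFactor z ^ 1 * jacobiThetaTwo z := by
    intro z hz
    have hz0 : z ≠ 0 := by rintro rfl; simp at hz
    have := jacobiTheta₂_functional_equation' (z / 2) hz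
    rw [show z / 2 / z = 1 / 2 by field_simp,
      show Real.pi * I * (z / 2) ^ 2 / z = Real.pi * I * z / 4 by field_simp; ring] at this
    rw [jacobiThetaFour, this, jacobiThetaTwo, pow_one, mul_assoc]
  exact
  { diffA := differentiableOn_jacobiTheta₂ _
    diffB := differentiableOn_jacobiTheta₂ _
    diffC := by
      intro z hz
      have h1 : DifferentiableAt ℂ (fun z : ℂ => jacobiTheta₂ (z / 2) z) z := by
        have h2 := (hasFDerivAt_jacobiTheta₂ (z / 2) hz).differentiableAt
        exact h2.comp (f := fun z : ℂ => ((z / 2, z) : ℂ × ℂ)) z (by fun_prop)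
      exact (DifferentiableAt.mul (by fun_prop) h1).differentiableWithinAt
    A_add := fun z hz => by rw [jacobiThetaThree, jacobiTheta₂_add_one, zero_add]; rfl
    B_add := fun z hz => by
      rw [jacobiThetaFour, jacobiTheta₂_add_one, show (1 / 2 + 1 / 2 : ℂ) = 0 + 1 by ring,
        jacobiTheta₂_add_left]; rfl
    C_add := fun z hz => by
      rw [jacobiThetaTwo, jacobiThetaTwo, jacobiTheta₂_add_one,
        show ((z + 1) / 2 + 1 / 2 : ℂ) = z / 2 + 1 by ring, jacobiTheta₂_add_left, pow_one,
        ← mul_assoc, ← exp_add]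
      congr 2
      ring
    A_inv := fun z hz => by
      have := jacobiTheta₂_functional_equation' 0 hz
      rw [zero_div, zero_pow two_ne_zero, mul_zero, zero_div, exp_zero, mul_one] at this
      rw [jacobiThetaThree, this, pow_one]
      rfl
    B_inv := hB
    C_inv := fun z hz => inv_formula_symm hB hz }

/-- The weight four form `Δ₈ = θ₂⁴ θ₄⁴ / 16` on the theta group. -/
noncomputable def deltaEight (z : ℂ) : ℂ := jacobiThetaTwo z ^ 4 * jacobiThetaFour z ^ 4 / 16

/-- `θ₂⁴` changes sign under `z ↦ z + 1`, hence the minus signs. The third component has the nonzero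
limit `-1/16` at `i∞`, whereas `θ₂` vanishes there, so the third components of `θ₃ⁿ⁻⁸ʲ Δ₈ʲ` have
distinct orders of vanishing. -/
theorem isThetaTriple_deltaEight :
    IsThetaTriple 8 deltaEight (fun z => -(jacobiThetaTwo z ^ 4 * jacobiThetaThree z ^ 4) / 16)
      (fun z => -(jacobiThetaThree z * jacobiThetaFour z) ^ 4 / 16) := by
  have h := isThetaTriple_jacobi
  have he : exp (Real.pi * I / 4) ^ 4 = -1 := by
    rw [← exp_nat_mul, show ((4 : ℕ) : ℂ) * (Real.pi * I / 4) = Real.pi * I by push_cast; ring,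
      exp_pi_mul_I]
  have hB : ∀ z : ℂ, 0 < z.im →
      (fun z => -(jacobiThetaTwo z ^ 4 * jacobiThetaThree z ^ 4) / 16) (-1 / z) = thetaFactor z ^ 8 *
        (fun z => -(jacobiThetaThree z * jacobiThetaFour z) ^ 4 / 16) z := by
    intro z hz
    beta_reduce
    rw [h.A_inv z hz, h.C_inv z hz]; ring
  have hC := fun (z : ℂ) (hz : 0 < z.im) => inv_formula_symm
    (B := fun z => -(jacobiThetaTwo z ^ 4 * jacobiThetaThree z ^ 4) / 16)
    (C := fun z => -(jacobiThetaThree z * jacobiThetaFour z) ^ 4 / 16) hB hz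
  exact
  { diffA := ((h.diffC.pow 4).mul (h.diffB.pow 4)).div_const _
    diffB := ((h.diffC.pow 4).mul (h.diffA.pow 4)).neg.div_const _
    diffC := ((h.diffA.mul h.diffB).pow 4).neg.div_const _
    A_add := fun z hz => by
      rw [deltaEight, h.B_add z hz, h.C_add z hz]
      linear_combination (jacobiThetaTwo z ^ 4 * jacobiThetaThree z ^ 4 / 16) * he
    B_add := fun z hz => by
      rw [deltaEight, h.A_add z hz, h.C_add z hz]
      linear_combination (-jacobiThetaTwo z ^ 4 * jacobiThetaFour z ^ 4 / 16) * he
    C_add := fun z hz => by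
      rw [h.A_add z hz, h.B_add z hz]
      linear_combination ((jacobiThetaThree z * jacobiThetaFour z) ^ 4 / 16) *
        (exp (Real.pi * I / 4) ^ 4 - 1) * he
    A_inv := fun z hz => by
      rw [deltaEight, deltaEight, h.B_inv z hz, h.C_inv z hz]; ring
    B_inv := hB
    C_inv := hC }

end

section
open Complex Filter Topology

/-! ### Generating series -/

/-- The generating series `∑ i, q ^ m i` of a family of exponents. -/
noncomputable def countSeries {ι : Type*} (m : ι → ℕ) (q : ℂ) : ℂ := ∑' i, q ^ m i

/-- The family of exponents `m` takes every value finitely often, with subexponential growth. -/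
def SubexpExponents {ι : Type*} (m : ι → ℕ) : Prop :=
  ∀ r : ℝ, 0 < r → r < 1 → Summable fun i => r ^ m i

namespace SubexpExponents

variable {ι : Type*} {m : ι → ℕ}

theorem comp_injective {κ : Type*} (h : SubexpExponents m) {f : κ → ι} (hf : Function.Injective f) :
    SubexpExponents (fun i => m (f i)) := fun r h0 h1 => (h r h0 h1).comp_injective hf

theorem sub_const (h : SubexpExponents m) {k : ℕ} (hk : ∀ i, k ≤ m i) :
    SubexpExponents (fun i => m i - k) := fun r h0 h1 => by
  refine ((h r h0 h1).mul_left (r ^ k)⁻¹).congr fun i => ?_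
  rw [pow_sub₀ _ h0.ne' (hk i), mul_comm]

theorem summable_of_norm_lt_one (h : SubexpExponents m) {q : ℂ} (hq : ‖q‖ < 1) :
    Summable fun i => q ^ m i := by
  obtain ⟨r, hr1, hr2⟩ := exists_between hq
  refine Summable.of_norm_bounded (h r ((norm_nonneg q).trans_lt hr1) hr2) fun i => ?_
  rw [norm_pow]
  exact pow_le_pow_left₀ (norm_nonneg _) hr1.le _

theorem differentiableOn (h : SubexpExponents m) :
    DifferentiableOn ℂ (countSeries m) (Metric.ball 0 1) := by
  intro q hq
  rw [mem_ball_zero_iff] at hq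
  obtain ⟨r, hr1, hr2⟩ := exists_between hq
  have h1 : DifferentiableOn ℂ (countSeries m) (Metric.ball 0 r) := by
    refine differentiableOn_tsum_of_summable_norm (h r ((norm_nonneg q).trans_lt hr1) hr2)
      (fun i => (differentiable_pow _).differentiableOn) Metric.isOpen_ball fun i w hw => ?_
    rw [norm_pow]
    exact pow_le_pow_left₀ (norm_nonneg _) (mem_ball_zero_iff.1 hw).le _
  exact (h1.differentiableAt (Metric.isOpen_ball.mem_nhds (by simpa using hr1))).differentiableWithinAt

theorem analyticAt (h : SubexpExponents m) : AnalyticAt ℂ (countSeries m) 0 :=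
  h.differentiableOn.analyticAt (Metric.ball_mem_nhds _ one_pos)

theorem finite_fiber (h : SubexpExponents m) (c : ℕ) : {i | m i = c}.Finite := by
  have h1 := (h (1 / 2) (by norm_num) (by norm_num)).tendsto_cofinite_zero
  have h2 := h1.eventually_lt_const (pow_pos (by norm_num : (0 : ℝ) < 1 / 2) c)
  rw [Filter.eventually_cofinite] at h2
  refine h2.subset fun i hi => ?_
  rw [Set.mem_ofPred_eq] at hi
  simp [hi]

theorem countSeries_zero (h : SubexpExponents m) :
    countSeries m 0 = ({i | m i = 0}.ncard : ℂ) := by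
  have hf := h.finite_fiber 0
  rw [countSeries, tsum_eq_sum (s := hf.toFinset) (fun i hi => zero_pow (by simpa using hi)),
    Set.ncard_eq_toFinset_card _ hf]
  rw [Finset.sum_congr rfl (g := fun _ => (1 : ℂ)) (fun i hi => ?_)]
  · simp
  · have : m i = 0 := by simpa using hi
    rw [this, pow_zero]

theorem norm_countSeries_le (h : SubexpExponents m) {q : ℂ} {r : ℝ} (hr : 0 < r) (hr1 : r < 1)
    (hq : ‖q‖ ≤ r) : ‖countSeries m q‖ ≤ ∑' i, r ^ m i := by
  refine tsum_of_norm_bounded (h r hr hr1).hasSum fun i => ?_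
  rw [norm_pow]
  exact pow_le_pow_left₀ (norm_nonneg _) hq _

/-- If a single exponent is zero and the others are at least `k`, the generating series is
`1 + q ^ k R(q)` where `R(0)` is the number of exponents equal to `k`. -/
theorem exists_countSeries_eq (h : SubexpExponents m) {i₀ : ι} (h0 : m i₀ = 0) {k : ℕ}
    (hk0 : 0 < k) (hk : ∀ i, i ≠ i₀ → k ≤ m i) :
    ∃ R : ℂ → ℂ, AnalyticAt ℂ R 0 ∧ R 0 = ({i | m i = k}.ncard : ℂ) ∧
      ∀ q : ℂ, ‖q‖ < 1 → countSeries m q = 1 + q ^ k * R q := by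
  classical
  have hsub : SubexpExponents (fun i : {i // i ≠ i₀} => m i - k) :=
    (h.comp_injective Subtype.val_injective).sub_const fun i => hk i i.2
  refine ⟨countSeries fun i : {i // i ≠ i₀} => m i - k, hsub.analyticAt, ?_, fun q hq => ?_⟩
  · rw [hsub.countSeries_zero]
    congr 1
    rw [← Set.ncard_image_of_injective _ Subtype.val_injective]
    congr 1
    ext i
    simp only [Set.mem_image, Set.mem_ofPred_eq, Subtype.exists, exists_and_left, exists_prop]
    constructor
    · rintro ⟨i, h1, h2, rfl⟩
      have := hk i h2
      omega
    · intro h1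
      refine ⟨i, by omega, ?_, rfl⟩
      rintro rfl
      omega
  · have hs := h.summable_of_norm_lt_one hq
    rw [countSeries, hs.tsum_eq_add_tsum_ite i₀, h0, pow_zero, countSeries, ← tsum_mul_left]
    congr 1
    have h2 : ∀ i, (if i = i₀ then 0 else q ^ m i) =
        Set.indicator {i | i ≠ i₀} (fun i => q ^ m i) i := by
      intro i
      by_cases hi : i = i₀ <;> simp [Set.indicator, hi]
    rw [tsum_congr h2, ← tsum_subtype {i | i ≠ i₀} (fun i => q ^ m i)]
    refine tsum_congr fun i => ?_
    rw [← pow_add, Nat.add_sub_cancel' (hk i i.2)]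

end SubexpExponents

theorem norm_exp_pi_I_mul (z : ℂ) : ‖exp (Real.pi * I * z)‖ = Real.exp (-Real.pi * z.im) := by
  have := norm_cexp_pi_I_mul 1 z
  simpa using this

theorem norm_exp_pi_I_mul_lt_one {z : ℂ} (hz : 0 < z.im) : ‖exp (Real.pi * I * z)‖ < 1 := by
  rw [norm_exp_pi_I_mul, Real.exp_lt_one_iff]
  nlinarith [Real.pi_pos]

/-! ### Theta functions of unimodular lattices as theta triples -/

namespace IsUnimodularLattice

variable {n : ℕ} {Λ : Submodule ℤ (EuclideanSpace ℝ (Fin n))}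

theorem exists_norm_sq_eq_natCast (h : IsUnimodularLattice Λ) {x : EuclideanSpace ℝ (Fin n)}
    (hx : x ∈ Λ) : ∃ m : ℕ, ‖x‖ ^ 2 = m := by
  obtain ⟨m, hm⟩ := h.integral x hx x hx
  rw [real_inner_self_eq_norm_sq] at hm
  have h0 : (0 : ℝ) ≤ m := hm ▸ sq_nonneg _
  lift m to ℕ using by exact_mod_cast h0
  exact ⟨m, by exact_mod_cast hm⟩

theorem latticeTheta_eq_shiftedTheta (z : ℂ) : latticeTheta Λ z = shiftedTheta Λ 0 z := by
  simp [latticeTheta, shiftedTheta]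

/-- Exponential summability of the exponents `(‖x + a‖² - μ) / s`, when these are natural numbers. -/
theorem subexpExponents (h : IsUnimodularLattice Λ) (a : EuclideanSpace ℝ (Fin n)) {μ s : ℝ}
    (hs : 0 < s) {m : Λ → ℕ}
    (hm : ∀ x : Λ, ‖(x : EuclideanSpace ℝ (Fin n)) + a‖ ^ 2 = μ + s * m x) : SubexpExponents m := by
  intro r hr0 hr1
  set y : ℝ := -Real.log r / (Real.pi * s) with hy
  have hlog : Real.log r < 0 := Real.log_neg hr0 hr1
  have hy0 : 0 < y := div_pos (by linarith) (by positivity)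
  refine ((h.summable_gaussian hy0 a).mul_left (Real.exp (Real.pi * y * μ))).congr fun x => ?_
  rw [hm, ← Real.exp_add, ← Real.exp_log (pow_pos hr0 (m x)), Real.log_pow]
  congr 1
  rw [hy]
  field_simp
  ring

theorem shiftedTheta_eq_countSeries {a : EuclideanSpace ℝ (Fin n)}
    {μ s : ℝ} {m : Λ → ℕ}
    (hm : ∀ x : Λ, ‖(x : EuclideanSpace ℝ (Fin n)) + a‖ ^ 2 = μ + s * m x) (z : ℂ) :
    shiftedTheta Λ a z = exp (Real.pi * I * μ * z) * countSeries m (exp (Real.pi * I * s * z)) := by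
  rw [shiftedTheta, countSeries, ← tsum_mul_left]
  refine tsum_congr fun x => ?_
  rw [hm, ← exp_nat_mul, ← exp_add]
  congr 1
  push_cast
  ring

theorem differentiableOn_shiftedTheta (h : IsUnimodularLattice Λ) {a : EuclideanSpace ℝ (Fin n)}
    {μ s : ℝ} (hs : 0 < s) {m : Λ → ℕ}
    (hm : ∀ x : Λ, ‖(x : EuclideanSpace ℝ (Fin n)) + a‖ ^ 2 = μ + s * m x) :
    DifferentiableOn ℂ (shiftedTheta Λ a) {z | 0 < z.im} := by
  rw [funext (shiftedTheta_eq_countSeries hm)]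
  refine DifferentiableOn.mul (by fun_prop) ?_
  refine (h.subexpExponents a hs hm).differentiableOn.comp (by fun_prop) fun z hz => ?_
  rw [mem_ball_zero_iff, mul_assoc]
  refine norm_exp_pi_I_mul_lt_one ?_
  rw [im_ofReal_mul]
  exact mul_pos hs hz

/-- The parity of a characteristic vector. -/
theorem _root_.IsCharacteristicVector.exists_inner_eq
    {w : EuclideanSpace ℝ (Fin n)} (hw : IsCharacteristicVector Λ w) (x : Λ) :
    ∃ m : ℤ, inner ℝ (x : EuclideanSpace ℝ (Fin n)) w =
      ‖(x : EuclideanSpace ℝ (Fin n))‖ ^ 2 + 2 * m := by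
  obtain ⟨m, hm⟩ := hw.2 x x.2
  refine ⟨m, ?_⟩
  rw [real_inner_self_eq_norm_sq] at hm
  rw [real_inner_comm]
  linarith

theorem _root_.IsCharacteristicVector.add_two_smul (h : IsUnimodularLattice Λ)
    {w : EuclideanSpace ℝ (Fin n)} (hw : IsCharacteristicVector Λ w)
    {x : EuclideanSpace ℝ (Fin n)} (hx : x ∈ Λ) : IsCharacteristicVector Λ (w + (2 : ℤ) • x) := by
  refine ⟨Λ.add_mem hw.1 (Λ.smul_mem _ hx), fun v hv => ?_⟩
  obtain ⟨m, hm⟩ := hw.2 v hv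
  obtain ⟨c, hc⟩ := h.integral x hx v hv
  refine ⟨m + c, ?_⟩
  rw [two_smul, inner_add_left, inner_add_left, hc]
  push_cast
  linarith

/-- For characteristic `w` the sign `exp (π i ‖x‖²)` equals `exp (π i (x, w))`, which is the
character produced by Poisson summation over the translate by `w / 2`. -/
theorem latticeTheta_add_one_eq (h : IsUnimodularLattice Λ) {w : EuclideanSpace ℝ (Fin n)}
    (hw : IsCharacteristicVector Λ w) {z : ℂ} (hz : 0 < z.im) :
    latticeTheta Λ (-1 / z + 1) = thetaFactor z ^ n * shiftedTheta Λ ((1 / 2 : ℝ) • w) z := by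
  rw [thetaFactor, h.shiftedTheta_eq _ hz, latticeTheta]
  refine tsum_congr fun x => ?_
  obtain ⟨m, hm⟩ := hw.exists_inner_eq x
  rw [← exp_add, inner_smul_right, hm]
  refine exp_eq_exp_iff_exists_int.2 ⟨-m, ?_⟩
  push_cast
  ring

theorem latticeTheta_add_two (h : IsUnimodularLattice Λ) (z : ℂ) :
    latticeTheta Λ (z + 2) = latticeTheta Λ z := by
  refine tsum_congr fun x => ?_
  obtain ⟨m, hm⟩ := h.exists_norm_sq_eq_natCast x.2
  refine exp_eq_exp_iff_exists_int.2 ⟨m, ?_⟩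
  rw [hm]
  push_cast
  ring

theorem latticeTheta_neg_one_div (h : IsUnimodularLattice Λ) {z : ℂ} (hz : 0 < z.im) :
    latticeTheta Λ (-1 / z) = thetaFactor z ^ n * latticeTheta Λ z := by
  rw [latticeTheta_eq_shiftedTheta z, thetaFactor, h.shiftedTheta_eq _ hz, latticeTheta]
  simp

theorem norm_add_half_sq (x w : EuclideanSpace ℝ (Fin n)) :
    ‖x + (1 / 2 : ℝ) • w‖ ^ 2 = ‖w‖ ^ 2 / 4 + (‖x‖ ^ 2 + inner ℝ x w) := by
  rw [norm_add_sq_real, inner_smul_right, norm_smul, Real.norm_of_nonneg (by norm_num)]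
  ring

/-- `‖x‖² + (x, w)` is even, so the norms on the shadow agree with `‖w‖² / 4` modulo `2`. -/
theorem shiftedTheta_add_one (h : IsUnimodularLattice Λ) {w : EuclideanSpace ℝ (Fin n)}
    (hw : IsCharacteristicVector Λ w) (z : ℂ) :
    shiftedTheta Λ ((1 / 2 : ℝ) • w) (z + 1) =
      exp (Real.pi * I * (‖w‖ ^ 2 / 4 : ℝ)) * shiftedTheta Λ ((1 / 2 : ℝ) • w) z := by
  rw [shiftedTheta, shiftedTheta, ← tsum_mul_left]
  refine tsum_congr fun x => ?_
  obtain ⟨m, hm⟩ := hw.exists_inner_eq x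
  obtain ⟨N, hN⟩ := h.exists_norm_sq_eq_natCast x.2
  rw [norm_add_half_sq, hm, hN, ← exp_add]
  refine exp_eq_exp_iff_exists_int.2 ⟨N + m, ?_⟩
  push_cast
  ring

theorem _root_.thetaFactor_I : thetaFactor I = 1 := by
  rw [thetaFactor, show -I * I = 1 by simp, one_cpow]

theorem _root_.thetaFactor_neg_one_add_I :
    thetaFactor (-1 + I) = exp (Real.pi * I / 4) * thetaFactor (1 + I) := by
  have h1 : (-I * (-1 + I)) = 1 + I := by linear_combination -I_sq
  have h2 : (-I * (1 + I)) = 1 - I := by linear_combination -I_sq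
  have hre : (1 - I).re = 1 := by simp
  have hne : (1 - I : ℂ) ≠ 0 := fun h => by rw [h] at hre; simp at hre
  have hne' : (1 + I : ℂ) ≠ 0 := fun h => by
    have : (1 + I).re = 1 := by simp
    rw [h] at this; simp at this
  have harg : |arg (1 - I)| < Real.pi / 2 := by
    rw [abs_arg_lt_pi_div_two_iff]
    left; simp
  rw [abs_lt] at harg
  -- This is `1 + i = i (1 - i)`; the bound on `arg (1 - i)` keeps the sum of the arguments in the
  -- principal branch.
  have hlog : log (1 + I) = Real.pi / 2 * I + log (1 - I) := by
    rw [← log_exp (x := Real.pi / 2 * I + log (1 - I)), exp_add, exp_log hne, exp_pi_div_two_mul_I]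
    · congr 1
      linear_combination I_sq
    · have : (Real.pi / 2 * I + log (1 - I)).im = Real.pi / 2 + arg (1 - I) := by
        rw [add_im, log_im]; congr 1; simp
      rw [this]; linarith [Real.pi_pos]
    · have : (Real.pi / 2 * I + log (1 - I)).im = Real.pi / 2 + arg (1 - I) := by
        rw [add_im, log_im]; congr 1; simp
      rw [this]; linarith [Real.pi_pos]
  rw [thetaFactor, thetaFactor, h1, h2, cpow_def_of_ne_zero hne, cpow_def_of_ne_zero hne', hlog,
    ← exp_add]
  congr 1
  ring

theorem shiftedTheta_I_ne_zero (h : IsUnimodularLattice Λ) (a : EuclideanSpace ℝ (Fin n)) :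
    shiftedTheta Λ a I ≠ 0 := by
  have h1 : shiftedTheta Λ a I =
      ((∑' x : Λ, Real.exp (-Real.pi * 1 * ‖(x : EuclideanSpace ℝ (Fin n)) + a‖ ^ 2) : ℝ) : ℂ) := by
    rw [ofReal_tsum]
    refine tsum_congr fun x => ?_
    rw [ofReal_exp]
    congr 1
    push_cast
    linear_combination Real.pi * (‖(x : EuclideanSpace ℝ (Fin n)) + a‖ : ℂ) ^ 2 * I_sq
  rw [h1, Ne, ofReal_eq_zero]
  exact ((h.summable_gaussian one_pos a).tsum_pos (fun _ => (Real.exp_pos _).le) 0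
    (Real.exp_pos _)).ne'

/-- The norm of a characteristic vector is congruent to the dimension modulo `8`. -/
theorem norm_sq_characteristic (h : IsUnimodularLattice Λ) {w : EuclideanSpace ℝ (Fin n)}
    (hw : IsCharacteristicVector Λ w) : ∃ t : ℤ, ‖w‖ ^ 2 = n + 8 * t := by
  have hI : 0 < I.im := by simp
  set C := shiftedTheta Λ ((1 / 2 : ℝ) • w) with hC
  have e1 : latticeTheta Λ (I + 1) = C I := by
    have := h.latticeTheta_add_one_eq hw hI
    rwa [show -1 / I = I by rw [neg_div, one_div, inv_I, neg_neg], thetaFactor_I, one_pow,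
      one_mul] at this
  have h1I : 0 < (1 + I).im := by simp
  have hm1I : 0 < (-1 + I).im := by simp
  have hne : (1 + I : ℂ) ≠ 0 := by intro h; simp [h] at h1I
  have hne' : (-1 + I : ℂ) ≠ 0 := by intro h; simp [h] at hm1I
  have e2 := h.latticeTheta_add_one_eq hw h1I
  have e3 := h.latticeTheta_neg_one_div hm1I
  -- Two routes to `Θ_Λ` at the same point both end at the shadow series at `i`, which is a positive
  -- sum. Comparing their factors gives `exp (π i ‖w‖² / 4) = exp (π i / 4) ^ n`.
  have e4 : (-1 : ℂ) / (-1 + I) = -1 / (1 + I) + 1 := by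
    field_simp
    linear_combination -I_sq
  have e5 : latticeTheta Λ (-1 + I) = C I := by
    rw [← e1, ← h.latticeTheta_add_two]; congr 1; ring
  rw [e4, e2, e5, add_comm 1 I, h.shiftedTheta_add_one hw, ← mul_assoc] at e3
  have e6 := mul_right_cancel₀ (h.shiftedTheta_I_ne_zero _) e3
  rw [thetaFactor_neg_one_add_I, add_comm 1 I, mul_pow, mul_comm] at e6
  have hr : thetaFactor (I + 1) ≠ 0 := by
    have hne : (I + 1 : ℂ) ≠ 0 := by rwa [add_comm]
    rw [thetaFactor, Ne, cpow_eq_zero_iff]; simp [hne]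
  have e7 := mul_right_cancel₀ (pow_ne_zero n hr) e6
  rw [← exp_nat_mul, exp_eq_exp_iff_exists_int] at e7
  obtain ⟨t, ht⟩ := e7
  refine ⟨t, ?_⟩
  have hπ : (Real.pi * I : ℂ) ≠ 0 := by simp [Real.pi_ne_zero]
  have e8 : ((‖w‖ ^ 2 / 4 : ℝ) : ℂ) = n / 4 + 2 * t := by
    apply mul_left_cancel₀ hπ
    rw [ht]; ring
  have e9 : (‖w‖ ^ 2 / 4 : ℝ) = n / 4 + 2 * t := by
    rw [← ofReal_inj, e8]; push_cast; ring
  linarith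

/-- The exponents `m` serve to make the shadow series holomorphic. The multiplier in `C_add` is the
right one because `‖w‖² ≡ n (mod 8)`. -/
theorem isThetaTriple (h : IsUnimodularLattice Λ) {w : EuclideanSpace ℝ (Fin n)}
    (hw : IsCharacteristicVector Λ w) {μ s : ℝ} (hs : 0 < s) {m : Λ → ℕ}
    (hm : ∀ x : Λ, ‖(x : EuclideanSpace ℝ (Fin n)) + (1 / 2 : ℝ) • w‖ ^ 2 = μ + s * m x) :
    IsThetaTriple n (latticeTheta Λ) (fun z => latticeTheta Λ (z + 1))
      (shiftedTheta Λ ((1 / 2 : ℝ) • w)) := by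
  have hB : ∀ z : ℂ, 0 < z.im → (fun z => latticeTheta Λ (z + 1)) (-1 / z) =
      thetaFactor z ^ n * shiftedTheta Λ ((1 / 2 : ℝ) • w) z := fun z hz =>
    h.latticeTheta_add_one_eq hw hz
  have hC := fun (z : ℂ) (hz : 0 < z.im) => inv_formula_symm
    (B := fun z => latticeTheta Λ (z + 1)) (C := shiftedTheta Λ ((1 / 2 : ℝ) • w)) hB hz
  have hdA : DifferentiableOn ℂ (latticeTheta Λ) {z | 0 < z.im} := by
    choose N hN using fun x : Λ => h.exists_norm_sq_eq_natCast x.2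
    rw [funext (latticeTheta_eq_shiftedTheta (Λ := Λ))]
    exact h.differentiableOn_shiftedTheta (μ := 0) one_pos (m := N) fun x => by simp [hN]
  exact
  { diffA := hdA
    diffB := hdA.comp (by fun_prop) fun z hz => by simpa using hz
    diffC := h.differentiableOn_shiftedTheta hs hm
    A_add := fun z hz => rfl
    B_add := fun z hz => by
      rw [← h.latticeTheta_add_two z]; congr 1; ring
    C_add := fun z hz => by
      rw [h.shiftedTheta_add_one hw]
      congr 1
      obtain ⟨t, ht⟩ := h.norm_sq_characteristic hw
      rw [ht, ← exp_nat_mul]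
      refine exp_eq_exp_iff_exists_int.2 ⟨t, ?_⟩
      push_cast
      ring
    A_inv := fun z hz => h.latticeTheta_neg_one_div hz
    B_inv := hB
    C_inv := hC }

end IsUnimodularLattice

end

section
open Complex Filter Topology

/-! ### `q`-expansions of the Jacobi theta functions -/

theorem subexpExponents_sq : SubexpExponents fun m : ℤ => m.natAbs ^ 2 := by
  intro r hr0 hr1
  have hlog : Real.log r < 0 := Real.log_neg hr0 hr1
  have hy : 0 < (((-Real.log r / Real.pi : ℝ) : ℂ) * I).im := by
    simp only [mul_im, ofReal_re, I_im, mul_one, ofReal_im, I_re, mul_zero, add_zero]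
    exact div_pos (by linarith) Real.pi_pos
  refine ((summable_jacobiTheta₂_term_iff 0 _).2 hy).norm.congr fun m => ?_
  rw [norm_jacobiTheta₂_term, ← Real.exp_log (pow_pos hr0 (m.natAbs ^ 2)), Real.log_pow]
  congr 1
  have h1 : ((m.natAbs ^ 2 : ℕ) : ℝ) = (m : ℝ) ^ 2 := by
    rw [Nat.cast_pow, Nat.cast_natAbs]
    exact_mod_cast sq_abs m
  rw [h1]
  simp only [mul_im, ofReal_re, I_im, mul_one, ofReal_im, I_re, mul_zero, add_zero, zero_im]
  field_simp
  ring

/-- The exponents `m (m + 1) / 2`, for `m : ℤ`. -/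
def triangular (m : ℤ) : ℕ := (m * (m + 1) / 2).toNat

theorem two_mul_triangular (m : ℤ) : 2 * (triangular m : ℤ) = m * (m + 1) := by
  have h1 := Int.ediv_mul_cancel (Int.even_mul_succ_self m).two_dvd
  have h2 : 0 ≤ m * (m + 1) := by
    rcases le_or_gt 0 m with h | h
    · positivity
    · nlinarith
  rw [triangular, Int.toNat_of_nonneg (by omega)]
  omega

theorem subexpExponents_triangular : SubexpExponents triangular := by
  intro r hr0 hr1
  have hlog : Real.log r < 0 := Real.log_neg hr0 hr1
  -- Chosen so that `exp (2πiz) = r`; the Jacobi terms at `u = z / 2` then have norm `r ^ (m (m + 1)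
  -- / 2)`.
  set z : ℂ := ((-Real.log r / (2 * Real.pi) : ℝ) : ℂ) * I with hz
  have him : z.im = -Real.log r / (2 * Real.pi) := by
    simp only [hz, mul_im, ofReal_re, I_im, mul_one, ofReal_im, I_re, mul_zero, add_zero]
  have hy : 0 < z.im := by
    rw [him]
    exact div_pos (by linarith) (by positivity)
  refine ((summable_jacobiTheta₂_term_iff (z / 2) _).2 hy).norm.congr fun m => ?_
  rw [norm_jacobiTheta₂_term, ← Real.exp_log (pow_pos hr0 (triangular m)), Real.log_pow]
  congr 1
  have h1 : (triangular m : ℝ) = (m : ℝ) * (m + 1) / 2 := by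
    have := two_mul_triangular m
    have : 2 * (triangular m : ℝ) = m * (m + 1) := by exact_mod_cast this
    linarith
  have h2 : (z / 2).im = z.im / 2 := by simp
  rw [h1, h2, him]
  field_simp
  ring

/-- The `q`-expansion of `θ₃`. -/
noncomputable def squareSeries : ℂ → ℂ := countSeries fun m : ℤ => m.natAbs ^ 2

theorem jacobiThetaThree_eq (z : ℂ) :
    jacobiThetaThree z = squareSeries (exp (Real.pi * I * z)) := by
  refine tsum_congr fun m => ?_
  rw [jacobiTheta₂_term, ← exp_nat_mul]
  congr 1
  have h1 : ((m.natAbs ^ 2 : ℕ) : ℂ) = (m : ℂ) ^ 2 := by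
    rw [Nat.cast_pow, Nat.cast_natAbs]
    exact_mod_cast sq_abs m
  rw [h1]
  ring

theorem jacobiThetaFour_eq (z : ℂ) :
    jacobiThetaFour z = squareSeries (-exp (Real.pi * I * z)) := by
  have h1 : jacobiThetaFour z = jacobiThetaThree (z + 1) := by
    rw [jacobiThetaThree, jacobiTheta₂_add_one, zero_add]; rfl
  rw [h1, jacobiThetaThree_eq]
  congr 1
  rw [mul_add, exp_add, mul_one, exp_pi_mul_I]
  ring

theorem jacobiThetaTwo_eq (z : ℂ) : jacobiThetaTwo z =
    exp (Real.pi * I * z / 4) * countSeries triangular (exp (2 * Real.pi * I * z)) := by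
  rw [jacobiThetaTwo, countSeries]
  congr 1
  refine tsum_congr fun m => ?_
  rw [jacobiTheta₂_term, ← exp_nat_mul]
  congr 1
  have h1 : 2 * (triangular m : ℂ) = m * (m + 1) := by exact_mod_cast two_mul_triangular m
  linear_combination (-(Real.pi * I * z)) * h1

theorem exists_squareSeries_eq : ∃ R : ℂ → ℂ, AnalyticAt ℂ R 0 ∧ R 0 = 2 ∧
    ∀ q : ℂ, ‖q‖ < 1 → squareSeries q = 1 + q * R q := by
  obtain ⟨R, hR, hR0, h⟩ := subexpExponents_sq.exists_countSeries_eq (i₀ := 0) (by simp) one_pos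
    (fun m hm => Nat.pos_of_ne_zero (by simpa using hm))
  refine ⟨R, hR, ?_, fun q hq => by rw [squareSeries, h q hq, pow_one]⟩
  rw [hR0]
  have : {m : ℤ | m.natAbs ^ 2 = 1} = {1, -1} := by
    ext m
    simp [Int.natAbs_eq_iff]
  rw [this, Set.ncard_pair (by norm_num)]
  norm_num

theorem squareSeries_zero : squareSeries 0 = 1 := by
  obtain ⟨R, -, -, h⟩ := exists_squareSeries_eq
  simpa using h 0 (by simp)

theorem analyticAt_squareSeries : AnalyticAt ℂ squareSeries 0 := subexpExponents_sq.analyticAt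

theorem countSeries_triangular_zero : countSeries triangular 0 = 2 := by
  rw [subexpExponents_triangular.countSeries_zero]
  have : {m : ℤ | triangular m = 0} = {0, -1} := by
    ext m
    have := two_mul_triangular m
    simp only [Set.mem_ofPred_eq, Set.mem_insert_iff, Set.mem_singleton_iff]
    constructor
    · intro h
      rw [h] at this
      rcases mul_eq_zero.1 (this.symm.trans (by simp)) with h | h <;> omega
    · rintro (rfl | rfl) <;> simp [triangular]
  rw [this, Set.ncard_pair (by norm_num)]
  norm_num

/-- `Δ₈ = q E(q)`. -/
noncomputable def deltaEightSeries (q : ℂ) : ℂ :=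
  countSeries triangular (q ^ 2) ^ 4 * squareSeries (-q) ^ 4 / 16

theorem deltaEight_eq (z : ℂ) : deltaEight z =
    exp (Real.pi * I * z) * deltaEightSeries (exp (Real.pi * I * z)) := by
  rw [deltaEight, deltaEightSeries, jacobiThetaTwo_eq, jacobiThetaFour_eq, mul_pow]
  have h1 : exp (Real.pi * I * z / 4) ^ 4 = exp (Real.pi * I * z) := by
    rw [← exp_nat_mul]; congr 1; push_cast; ring
  have h2 : exp (2 * Real.pi * I * z) = exp (Real.pi * I * z) ^ 2 := by
    rw [← exp_nat_mul]; congr 1; push_cast; ring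
  rw [h1, h2]
  ring

theorem analyticAt_deltaEightSeries : AnalyticAt ℂ deltaEightSeries 0 := by
  have h1 : AnalyticAt ℂ (fun q : ℂ => countSeries triangular (q ^ 2)) 0 := by
    refine AnalyticAt.fun_comp (g := countSeries triangular) ?_ (by fun_prop)
    simpa using subexpExponents_triangular.analyticAt
  have h2 : AnalyticAt ℂ (fun q : ℂ => squareSeries (-q)) 0 := by
    refine AnalyticAt.fun_comp (g := squareSeries) ?_ (by fun_prop)
    simpa using analyticAt_squareSeries
  exact ((h1.pow 4).mul (h2.pow 4)).div_const

theorem deltaEightSeries_zero : deltaEightSeries 0 = 1 := by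
  rw [deltaEightSeries, neg_zero, zero_pow two_ne_zero, countSeries_triangular_zero,
    squareSeries_zero]
  norm_num

theorem tendsto_exp_mul_I_atTop {c : ℝ} (hc : 0 < c) :
    Tendsto (fun y : ℝ => exp (c * I * (y * I))) atTop (𝓝 0) := by
  rw [tendsto_zero_iff_norm_tendsto_zero]
  have h1 : ∀ y : ℝ, ‖exp (c * I * (y * I))‖ = Real.exp (-c * y) := by
    intro y
    rw [show (c * I * (y * I) : ℂ) = ((-c * y : ℝ) : ℂ) by
      push_cast; linear_combination (c * y : ℂ) * I_sq, norm_exp_ofReal]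
  simp only [h1]
  exact Real.tendsto_exp_atBot.comp (tendsto_id.const_mul_atTop_of_neg (by linarith))

theorem SubexpExponents.exists_norm_le {ι : Type*} {m : ι → ℕ} (h : SubexpExponents m) :
    ∃ K : ℝ, ∀ q : ℂ, ‖q‖ ≤ Real.exp (-Real.pi) → ‖countSeries m q‖ ≤ K :=
  ⟨_, fun _ hq => h.norm_countSeries_le (Real.exp_pos _)
    (Real.exp_lt_one_iff.2 (by linarith [Real.pi_pos])) hq⟩

theorem norm_exp_pi_I_mul_le {z : ℂ} (hz : 1 ≤ z.im) :
    ‖exp (Real.pi * I * z)‖ ≤ Real.exp (-Real.pi) := by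
  rw [norm_exp_pi_I_mul, Real.exp_le_exp]
  nlinarith [Real.pi_pos]

theorem exists_norm_jacobiThetaThree_le :
    ∃ K : ℝ, ∀ z : ℂ, 1 ≤ z.im → ‖jacobiThetaThree z‖ ≤ K := by
  obtain ⟨K, hK⟩ := subexpExponents_sq.exists_norm_le
  exact ⟨K, fun z hz => by
    rw [jacobiThetaThree_eq]; exact hK _ (norm_exp_pi_I_mul_le hz)⟩

theorem exists_norm_jacobiThetaFour_le :
    ∃ K : ℝ, ∀ z : ℂ, 1 ≤ z.im → ‖jacobiThetaFour z‖ ≤ K := by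
  obtain ⟨K, hK⟩ := subexpExponents_sq.exists_norm_le
  exact ⟨K, fun z hz => by
    rw [jacobiThetaFour_eq]; exact hK _ (by rw [norm_neg]; exact norm_exp_pi_I_mul_le hz)⟩

theorem exists_norm_deltaEight_le :
    ∃ K : ℝ, ∀ z : ℂ, 1 ≤ z.im → ‖deltaEight z‖ ≤ K := by
  obtain ⟨K, hK⟩ := subexpExponents_triangular.exists_norm_le
  obtain ⟨K', hK'⟩ := exists_norm_jacobiThetaFour_le
  refine ⟨K ^ 4 * K' ^ 4 / 16, fun z hz => ?_⟩
  have h2 : exp (2 * Real.pi * I * z) = exp (Real.pi * I * z) * exp (Real.pi * I * z) := by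
    rw [← exp_add]; congr 1; ring
  have h1 : ‖exp (Real.pi * I * z)‖ ≤ 1 := (norm_exp_pi_I_mul_lt_one (by linarith)).le
  have h3 : ‖jacobiThetaTwo z‖ ≤ K := by
    rw [jacobiThetaTwo_eq, norm_mul]
    have h4 : ‖exp (Real.pi * I * z / 4)‖ ≤ 1 := by
      rw [mul_div_assoc]
      refine (norm_exp_pi_I_mul_lt_one ?_).le
      have : (z / 4).im = z.im / 4 := by simp
      rw [this]; linarith
    refine (mul_le_of_le_one_left (norm_nonneg _) h4).trans (hK _ ?_)
    rw [h2, norm_mul]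
    exact (mul_le_of_le_one_left (norm_nonneg _) h1).trans (norm_exp_pi_I_mul_le hz)
  rw [deltaEight, norm_div, norm_mul, norm_pow, norm_pow]
  have : ‖(16 : ℂ)‖ = 16 := by simp
  rw [this]
  have h0 := (norm_nonneg _).trans h3
  gcongr
  exact hK' z hz

/-- The product `θ₃ θ₄` is a power series in `exp (2πiz)`. -/
theorem exists_thetaThree_mul_thetaFour : ∃ U : ℂ → ℂ, AnalyticAt ℂ U 0 ∧ U 0 = 1 ∧
    ∀ z : ℂ, jacobiThetaThree z * jacobiThetaFour z = U (exp (2 * Real.pi * I * z)) := by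
  set c : ℂ → ℂ := fun z => jacobiThetaThree z * jacobiThetaFour z with hc
  -- Translation by one exchanges `θ₃` and `θ₄`, so the product has period one. Boundedness at `i∞`
  -- removes the singularity of its cusp function.
  have hper : Function.Periodic c ((1 : ℝ) : ℂ) := by
    intro z
    simp only [hc, jacobiThetaThree, jacobiThetaFour, ofReal_one]
    rw [jacobiTheta₂_add_one, jacobiTheta₂_add_one, show (1 / 2 + 1 / 2 : ℂ) = 0 + 1 by ring,
        jacobiTheta₂_add_left, zero_add, mul_comm]
  have hdiff : ∀ z : ℂ, 0 < z.im → DifferentiableAt ℂ c z := fun z hz =>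
    (differentiableAt_jacobiTheta₂_snd _ hz).mul (differentiableAt_jacobiTheta₂_snd _ hz)
  have hbd : BoundedAtFilter (comap im atTop) c := by
    obtain ⟨K, hK⟩ := exists_norm_jacobiThetaThree_le
    obtain ⟨K', hK'⟩ := exists_norm_jacobiThetaFour_le
    refine Asymptotics.IsBigO.of_bound (K * K') ?_
    filter_upwards [preimage_mem_comap (Ici_mem_atTop 1)] with z hz
    have h0 := (norm_nonneg _).trans (hK z hz)
    rw [Pi.one_apply, norm_one, mul_one, hc, norm_mul]
    exact mul_le_mul (hK z hz) (hK' z hz) (norm_nonneg _) h0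
  have hev : ∀ᶠ z in comap im atTop, DifferentiableAt ℂ c z := by
    filter_upwards [preimage_mem_comap (Ioi_mem_atTop 0)] with z hz using hdiff z hz
  have hU : AnalyticAt ℂ (Function.Periodic.cuspFunction 1 c) 0 := by
    refine analyticAt_iff_eventually_differentiableAt.2 ?_
    have h1 := Function.Periodic.eventually_differentiableAt_cuspFunction_nhds_ne_zero one_pos
      hper hev
    rw [eventually_nhdsWithin_iff] at h1
    filter_upwards [h1] with q hq
    by_cases h : q = 0
    · rw [h]
      exact Function.Periodic.differentiableAt_cuspFunction_zero one_pos hper hev hbd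
    · exact hq h
  have hUc : ∀ z, c z = Function.Periodic.cuspFunction 1 c (exp (2 * Real.pi * I * z)) := by
    intro z
    have := Function.Periodic.eq_cuspFunction one_ne_zero hper z
    rw [← this, Function.Periodic.qParam]
    simp
  refine ⟨_, hU, ?_, hUc⟩
  have h1 : Tendsto (fun y : ℝ => c (y * I)) atTop (𝓝 (Function.Periodic.cuspFunction 1 c 0)) := by
    simp only [hUc]
    have := tendsto_exp_mul_I_atTop (c := 2 * Real.pi) (by positivity)
    push_cast at this
    exact hU.continuousAt.tendsto.comp this
  have h2 : Tendsto (fun y : ℝ => c (y * I)) atTop (𝓝 1) := by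
    simp only [hc, jacobiThetaThree_eq, jacobiThetaFour_eq]
    have h3 := tendsto_exp_mul_I_atTop Real.pi_pos
    have h4 : Tendsto squareSeries (𝓝 0) (𝓝 1) := by
      simpa [squareSeries_zero] using analyticAt_squareSeries.continuousAt.tendsto
    have h5 := (h4.comp h3).mul (h4.comp (by simpa using h3.neg))
    simpa using h5
  exact tendsto_nhds_unique h1 h2

/-- Elimination of the leading terms of a power series. -/
theorem exists_eq_sum_add_pow_mul (k : ℕ) {P : ℂ → ℂ} (hP : AnalyticAt ℂ P 0) {V : ℕ → ℂ → ℂ}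
    (hV : ∀ i, i < k → AnalyticAt ℂ (V i) 0) (hV0 : ∀ i, i < k → V i 0 ≠ 0) :
    ∃ (c : ℕ → ℂ) (R : ℂ → ℂ), AnalyticAt ℂ R 0 ∧
      ∀ Q, P Q = ∑ i ∈ Finset.range k, c i * (Q ^ i * V i Q) + Q ^ k * R Q := by
  induction k with
  | zero => exact ⟨0, P, hP, by simp⟩
  | succ k ih =>
    obtain ⟨c, R, hR, h⟩ := ih (fun i hi => hV i (by omega)) (fun i hi => hV0 i (by omega))
    -- A multiple of `V k` cancels the constant term of the remainder, and `dslope` then divides by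
    -- `Q`.
    set f : ℂ → ℂ := fun Q => R Q - R 0 / V k 0 * V k Q with hf
    have hfa : AnalyticAt ℂ f 0 := hR.sub (analyticAt_const.mul (hV k (by omega)))
    have hf0 : f 0 = 0 := by
      simp only [hf]; rw [div_mul_cancel₀ _ (hV0 k (by omega)), sub_self]
    refine ⟨Function.update c k (R 0 / V k 0), dslope f 0, ?_, fun Q => ?_⟩
    · obtain ⟨p, hp⟩ := hfa
      exact ⟨_, hp.has_fpower_series_dslope_fslope⟩
    · have h1 := sub_smul_dslope f 0 Q
      rw [sub_zero, hf0, sub_zero, smul_eq_mul] at h1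
      rw [h Q, Finset.sum_range_succ, Function.update_self, pow_succ, mul_assoc, h1]
      have h2 : ∑ i ∈ Finset.range k, Function.update c k (R 0 / V k 0) i * (Q ^ i * V i Q) =
          ∑ i ∈ Finset.range k, c i * (Q ^ i * V i Q) :=
        Finset.sum_congr rfl fun i hi => by
          rw [Function.update_of_ne (Finset.mem_range.1 hi).ne]
      rw [h2]
      simp only [hf]
      ring

end

/-! ### The theta series of an `n - 8k` lattice. -/

section
open Complex Filter Topology

namespace IsNSubEightLattice

variable {n k : ℕ} {Λ : Submodule ℤ (EuclideanSpace ℝ (Fin n))}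

/-- Twice a shadow vector is `w + 2x`, again characteristic. Its norm is at least `n - 8k` and
congruent to `n` modulo `8`; dividing by `4` gives steps of `2` starting from `n / 4 - 2k`. -/
theorem exists_shadow_exponents (h : IsNSubEightLattice k Λ) {w : EuclideanSpace ℝ (Fin n)}
    (hw : IsCharacteristicVector Λ w) : ∃ m : Λ → ℕ, ∀ x : Λ,
      ‖(x : EuclideanSpace ℝ (Fin n)) + (1 / 2 : ℝ) • w‖ ^ 2 = (n / 4 - 2 * k : ℝ) + 2 * m x := by
  have hx : ∀ x : Λ, ∃ m : ℕ,
      ‖(x : EuclideanSpace ℝ (Fin n)) + (1 / 2 : ℝ) • w‖ ^ 2 = (n / 4 - 2 * k : ℝ) + 2 * m := by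
    intro x
    have hc := hw.add_two_smul h.unimodular x.2
    obtain ⟨t, ht⟩ := h.unimodular.norm_sq_characteristic hc
    have h1 := h.le_norm_sq _ hc
    have h2 : ‖w + (2 : ℤ) • (x : EuclideanSpace ℝ (Fin n))‖ ^ 2 =
        4 * ‖(x : EuclideanSpace ℝ (Fin n)) + (1 / 2 : ℝ) • w‖ ^ 2 := by
      have h3 : w + (2 : ℤ) • (x : EuclideanSpace ℝ (Fin n)) =
          (2 : ℝ) • ((x : EuclideanSpace ℝ (Fin n)) + (1 / 2 : ℝ) • w) := by
        rw [smul_add, smul_smul, two_smul, two_smul]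
        norm_num
        abel
      rw [h3, norm_smul, mul_pow]
      norm_num
    have h4 : (0 : ℝ) ≤ ((t + k : ℤ) : ℝ) := by push_cast; linarith
    have h5 : 0 ≤ t + k := by exact_mod_cast h4
    obtain ⟨m, hm⟩ := Int.eq_ofNat_of_zero_le h5
    refine ⟨m, ?_⟩
    have h6 : (t : ℝ) + k = m := by exact_mod_cast hm
    linarith
  choose m hm using hx
  exact ⟨m, hm⟩

/-- The theta series of an `n - 8k` lattice is a combination of the `θ₃ⁿ⁻⁸ʲ Δ₈ʲ` with `j ≤ k`. -/
theorem exists_theta_expansion (h : IsNSubEightLattice k Λ) (hn : 8 * k ≤ n) :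
    ∃ c : ℕ → ℂ, ∀ z : ℂ, 0 < z.im → latticeTheta Λ z =
      ∑ j ∈ Finset.range (k + 1), c j * (jacobiThetaThree z ^ (n - 8 * j) * deltaEight z ^ j) := by
  obtain ⟨w, hw⟩ := h.unimodular.exists_isCharacteristicVector
  obtain ⟨m, hm⟩ := h.exists_shadow_exponents hw
  obtain ⟨U, hU, hU0, hUc⟩ := exists_thetaThree_mul_thetaFour
  have hsub := h.unimodular.subexpExponents _ two_pos hm
  -- With `Q = exp (2πiz)`, the third component of `θ₃ⁿ⁻⁸ʲ Δ₈ʲ` is `exp (πi(n/4 - 2k)z) * Qⁱ * V i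
  -- Q` for `i = k - j`. Hence the elimination runs in reversed order of `j`.
  set V : ℕ → ℂ → ℂ := fun i Q => countSeries triangular Q ^ (n - 8 * (k - i)) *
    (-U Q ^ 4 / 16) ^ (k - i) with hV
  obtain ⟨c, R, hR, hc⟩ := exists_eq_sum_add_pow_mul (k + 1) hsub.analyticAt (V := V)
    (fun i _ => (subexpExponents_triangular.analyticAt.pow _).mul
      (((hU.pow 4).neg.div_const).pow _))
    (fun i _ => by
      simp only [hV]
      rw [countSeries_triangular_zero, hU0]
      exact mul_ne_zero (pow_ne_zero _ two_ne_zero) (pow_ne_zero _ (by norm_num)))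
  refine ⟨fun j => c (k - j), ?_⟩
  have hT : IsThetaTriple n _ _ _ := (h.unimodular.isThetaTriple hw two_pos hm).sub
    (IsThetaTriple.sum (Finset.range (k + 1)) (fun j => c (k - j)) fun j hj => by
      have h1 := (isThetaTriple_jacobi.pow (n - 8 * j)).mul (isThetaTriple_deltaEight.pow j)
      have h2 : 1 * (n - 8 * j) + 8 * j = n := by
        have := Finset.mem_range.1 hj
        omega
      rwa [h2] at h1)
  obtain ⟨K₀, hK₀⟩ : ∃ K : ℝ, ∀ z : ℂ, 1 ≤ z.im → ‖latticeTheta Λ z -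
      ∑ j ∈ Finset.range (k + 1), c (k - j) *
        (jacobiThetaThree z ^ (n - 8 * j) * deltaEight z ^ j)‖ ≤ K := by
    choose N hN using fun x : Λ => h.unimodular.exists_norm_sq_eq_natCast x.2
    have hN' : ∀ x : Λ, ‖(x : EuclideanSpace ℝ (Fin n)) + 0‖ ^ 2 = (0 : ℝ) + 1 * N x := fun x => by
      simp [hN]
    obtain ⟨K₁, hK₁⟩ := (h.unimodular.subexpExponents 0 one_pos hN').exists_norm_le
    obtain ⟨K₂, hK₂⟩ := exists_norm_jacobiThetaThree_le
    obtain ⟨K₃, hK₃⟩ := exists_norm_deltaEight_le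
    refine ⟨K₁ + ∑ j ∈ Finset.range (k + 1), ‖c (k - j)‖ * (K₂ ^ (n - 8 * j) * K₃ ^ j),
      fun z hz => (norm_sub_le _ _).trans (add_le_add ?_ ((norm_sum_le _ _).trans
        (Finset.sum_le_sum fun j _ => ?_)))⟩
    · rw [IsUnimodularLattice.latticeTheta_eq_shiftedTheta,
        IsUnimodularLattice.shiftedTheta_eq_countSeries hN']
      simpa using hK₁ _ (norm_exp_pi_I_mul_le hz)
    · have h2 := (norm_nonneg _).trans (hK₂ z hz)
      rw [norm_mul, norm_mul, norm_pow, norm_pow]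
      gcongr
      exacts [hK₂ z hz, hK₃ z hz]
  obtain ⟨M, δ, hδ, hM⟩ : ∃ M δ : ℝ, 0 < δ ∧ ∀ Q : ℂ, ‖Q‖ < δ → ‖R Q‖ ≤ M := by
    have h1 := hR.continuousAt.norm.eventually_lt_const (lt_add_one ‖R 0‖)
    obtain ⟨δ, hδ, h2⟩ := Metric.eventually_nhds_iff.1 h1
    exact ⟨_, δ, hδ, fun Q hQ => (h2 (by simpa using hQ)).le⟩
  obtain ⟨y₀, hy₁, hy₀⟩ : ∃ y₀ : ℝ, 1 ≤ y₀ ∧ Real.exp (-Real.pi * y₀) < δ := by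
    have h1 : Tendsto (fun y : ℝ => Real.exp (-Real.pi * y)) atTop (𝓝 0) :=
      Real.tendsto_exp_atBot.comp (tendsto_id.const_mul_atTop_of_neg (by linarith [Real.pi_pos]))
    exact ((eventually_ge_atTop 1).and (h1.eventually_lt_const hδ)).exists
  have hnorm2 : ∀ z : ℂ, exp (2 * Real.pi * I * z) = exp (Real.pi * I * z) ^ 2 := fun z => by
    rw [← exp_nat_mul]; congr 1; push_cast; ring
  have hCeq : ∀ z : ℂ, shiftedTheta Λ ((1 / 2 : ℝ) • w) z - ∑ j ∈ Finset.range (k + 1),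
      c (k - j) * (jacobiThetaTwo z ^ (n - 8 * j) *
        (-(jacobiThetaThree z * jacobiThetaFour z) ^ 4 / 16) ^ j) =
      exp (Real.pi * I * ((n / 4 - 2 * k : ℝ) : ℂ) * z) *
        (exp (2 * Real.pi * I * z) ^ (k + 1) * R (exp (2 * Real.pi * I * z))) := by
    intro z
    have h2 : exp (Real.pi * I * ((2 : ℝ) : ℂ) * z) = exp (2 * Real.pi * I * z) := by
      congr 1; push_cast; ring
    rw [IsUnimodularLattice.shiftedTheta_eq_countSeries hm, h2, hc, ← Finset.sum_range_reflect,
      mul_add, Finset.mul_sum, add_sub_right_comm, ← Finset.sum_sub_distrib,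
      Finset.sum_eq_zero, zero_add]
    intro j hj
    have hjk : j ≤ k := by have := Finset.mem_range.1 hj; omega
    rw [show k + 1 - 1 - j = k - j by omega]
    simp only [hV, hUc]
    rw [jacobiThetaTwo_eq, mul_pow, show k - (k - j) = j by omega]
    have h3 : exp (Real.pi * I * z / 4) ^ (n - 8 * j) =
        exp (Real.pi * I * ((n / 4 - 2 * k : ℝ) : ℂ) * z) * exp (2 * Real.pi * I * z) ^ (k - j) := by
      rw [← exp_nat_mul, ← exp_nat_mul, ← exp_add, Nat.cast_sub (by omega), Nat.cast_sub hjk]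
      congr 1
      push_cast
      ring
    rw [h3]
    ring
  intro z hz
  -- The decay exponent is `(n/4 - 2k) + 2(k + 1) = n/4 + 2`: the `k + 1` coefficients of the shadow
  -- series that can be matched are exactly what is needed.
  have hfin := hT.eq_zero_of_decay (K := max K₀ M) (y₀ := y₀) (by linarith)
    (fun z hz => (hK₀ z (hy₁.trans hz)).trans (le_max_left _ _))
    (fun z hz => by
      rw [← hT.A_add z (by linarith)]
      refine (hK₀ (z + 1) ?_).trans (le_max_left _ _)
      simpa using hy₁.trans hz)
    (fun z hz => by
      refine (congrArg norm (hCeq z)).le.trans ?_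
      have h1 : ‖exp (2 * Real.pi * I * z)‖ < δ := by
        rw [hnorm2, norm_pow, norm_exp_pi_I_mul, sq]
        have h2 : Real.exp (-Real.pi * z.im) ≤ Real.exp (-Real.pi * y₀) :=
          Real.exp_le_exp.2 (by nlinarith [Real.pi_pos])
        have h3 : Real.exp (-Real.pi * z.im) ≤ 1 := by
          rw [Real.exp_le_one_iff]; nlinarith [Real.pi_pos]
        have := Real.exp_pos (-Real.pi * z.im)
        nlinarith
      rw [norm_mul, norm_mul, norm_cexp_pi_I_mul, hnorm2, norm_pow, norm_pow, norm_exp_pi_I_mul,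
        ← hnorm2, ← pow_mul, ← Real.exp_nat_mul, ← mul_assoc, ← Real.exp_add, mul_comm]
      refine mul_le_mul ((hM _ h1).trans (le_max_right _ _)) (le_of_eq ?_) (Real.exp_pos _).le
        (((norm_nonneg _).trans (hM _ h1)).trans (le_max_right _ _))
      congr 1
      push_cast
      ring) hz
  exact sub_eq_zero.1 hfin

end IsNSubEightLattice

end

section
open Filter Topology

/-! ### Taylor series -/

/-- The Taylor series at `0` of a function of a complex variable. -/
noncomputable def taylorSeries (f : ℂ → ℂ) : PowerSeries ℂ :=
  PowerSeries.mk fun m => iteratedDeriv m f 0 / m.factorial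

theorem taylorSeries_congr {f g : ℂ → ℂ} (h : f =ᶠ[𝓝 0] g) : taylorSeries f = taylorSeries g := by
  ext m
  simp [taylorSeries, (h.iteratedDeriv m).eq_of_nhds]

theorem taylorSeries_mul {f g : ℂ → ℂ} (hf : AnalyticAt ℂ f 0) (hg : AnalyticAt ℂ g 0) :
    taylorSeries (f * g) = taylorSeries f * taylorSeries g := by
  ext m
  simp only [taylorSeries, PowerSeries.coeff_mk, iteratedDeriv_mul hf.contDiffAt hg.contDiffAt,
    PowerSeries.coeff_mul, Finset.Nat.sum_antidiagonal_eq_sum_range_succ_mk, Nat.succ_eq_add_one,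
    Finset.sum_div]
  refine Finset.sum_congr rfl fun i hi => ?_
  rw [Nat.cast_choose _ (by grind)]
  field_simp [Nat.factorial_ne_zero]

theorem taylorSeries_add {f g : ℂ → ℂ} (hf : AnalyticAt ℂ f 0) (hg : AnalyticAt ℂ g 0) :
    taylorSeries (f + g) = taylorSeries f + taylorSeries g := by
  ext m
  simp [taylorSeries, iteratedDeriv_add hf.contDiffAt hg.contDiffAt, add_div]

theorem taylorSeries_const (c : ℂ) : taylorSeries (fun _ => c) = PowerSeries.C c := by
  ext m
  simp only [taylorSeries, PowerSeries.coeff_mk, PowerSeries.coeff_C, iteratedDeriv_const]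
  split_ifs with h <;> simp [h]

theorem taylorSeries_pow {f : ℂ → ℂ} (hf : AnalyticAt ℂ f 0) (j : ℕ) :
    taylorSeries (f ^ j) = taylorSeries f ^ j := by
  induction j with
  | zero => rw [pow_zero, pow_zero]; exact (taylorSeries_const 1).trans (map_one _)
  | succ j ih => rw [pow_succ, taylorSeries_mul (hf.pow j) hf, ih, pow_succ]

theorem taylorSeries_sum {ι : Type*} (s : Finset ι) {f : ι → ℂ → ℂ}
    (hf : ∀ i, AnalyticAt ℂ (f i) 0) :
    taylorSeries (∑ i ∈ s, f i) = ∑ i ∈ s, taylorSeries (f i) := by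
  classical
  induction s using Finset.induction_on with
  | empty =>
    rw [Finset.sum_empty, Finset.sum_empty]
    exact (taylorSeries_const 0).trans (map_zero _)
  | insert i s hi ih =>
    rw [Finset.sum_insert hi, Finset.sum_insert hi, taylorSeries_add (hf i)
      (Finset.analyticAt_sum s fun i _ => hf i), ih]

theorem taylorSeries_id : taylorSeries (fun q => q) = PowerSeries.X := by
  ext m
  rw [taylorSeries, PowerSeries.coeff_mk, iteratedDeriv_fun_id_zero, PowerSeries.coeff_X]
  split_ifs with h <;> simp [h]

theorem coeff_zero_taylorSeries (f : ℂ → ℂ) : PowerSeries.coeff 0 (taylorSeries f) = f 0 := by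
  simp [taylorSeries]

/-! ### Coefficients of powers of power series -/

/-- The binomial theorem, with the sum cut off at `i` instead of `N` so that the number of terms
stays fixed as `N` grows. Extra terms vanish on either side. -/
theorem PowerSeries.coeff_one_add_X_mul_pow_mul (v w : PowerSeries ℂ) (N i : ℕ) :
    PowerSeries.coeff i ((1 + PowerSeries.X * v) ^ N * w) =
      ∑ l ∈ Finset.range (i + 1), (N.choose l : ℂ) * PowerSeries.coeff (i - l) (v ^ l * w) := by
  set f : ℕ → ℂ := fun l => (N.choose l : ℂ) *
    if l ≤ i then PowerSeries.coeff (i - l) (v ^ l * w) else 0 with hf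
  have h1 : PowerSeries.coeff i ((1 + PowerSeries.X * v) ^ N * w) =
      ∑ l ∈ Finset.range (N + 1), f l := by
    rw [add_comm, add_pow, Finset.sum_mul, map_sum]
    refine Finset.sum_congr rfl fun l _ => ?_
    have h2 : (PowerSeries.X * v) ^ l * 1 ^ (N - l) * (N.choose l : PowerSeries ℂ) * w =
        (N.choose l) • (PowerSeries.X ^ l * (v ^ l * w)) := by
      rw [nsmul_eq_mul]; ring
    rw [h2, map_nsmul, PowerSeries.coeff_X_pow_mul', nsmul_eq_mul]
  have h2 : ∑ l ∈ Finset.range (N + 1), f l = ∑ l ∈ Finset.range (N + i + 1), f l := by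
    refine Finset.sum_subset (Finset.range_mono (by omega)) fun l _ hl => ?_
    rw [Finset.mem_range, not_lt] at hl
    simp only [hf]
    rw [Nat.choose_eq_zero_of_lt (by omega), Nat.cast_zero, zero_mul]
  have h3 : ∑ l ∈ Finset.range (i + 1), f l = ∑ l ∈ Finset.range (N + i + 1), f l := by
    refine Finset.sum_subset (Finset.range_mono (by omega)) fun l _ hl => ?_
    rw [Finset.mem_range, not_lt] at hl
    simp only [hf]
    rw [if_neg (by omega), mul_zero]
  rw [h1, h2, ← h3]
  refine Finset.sum_congr rfl fun l hl => ?_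
  simp only [hf]
  rw [if_pos (by have := Finset.mem_range.1 hl; omega)]

theorem tendsto_choose_sub_div_pow (s l : ℕ) :
    Tendsto (fun n : ℕ => ((n - s).choose l : ℂ) / (n : ℂ) ^ l) atTop (𝓝 (1 / l.factorial)) := by
  rw [← tendsto_add_atTop_iff_nat s]
  -- After shifting by `s` this is the combinatorial part of the Poisson limit law with success
  -- probability `1 / (n + s)`.
  have h1 : Tendsto (fun n : ℕ => (n : ℝ) * (1 / ((n : ℝ) + s))) atTop (𝓝 1) := by
    have := tendsto_natCast_div_add_atTop (𝕜 := ℝ) (s : ℝ)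
    refine this.congr fun n => ?_
    ring
  have h2 := ProbabilityTheory.tendsto_choose_mul_pow_atTop l h1
  have h3 := (Complex.continuous_ofReal.tendsto _).comp h2
  rw [one_pow, Complex.ofReal_div, Complex.ofReal_one, Complex.ofReal_natCast] at h3
  refine h3.congr fun n => ?_
  rw [Nat.add_sub_cancel]
  simp [div_eq_mul_inv]

/-- Asymptotics of a fixed coefficient of a large power of a power series. -/
theorem tendsto_coeff_pow_div_pow (v w : PowerSeries ℂ) (s i : ℕ) :
    Tendsto (fun n : ℕ => PowerSeries.coeff i ((1 + PowerSeries.X * v) ^ (n - s) * w) / (n : ℂ) ^ i)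
      atTop (𝓝 (PowerSeries.coeff 0 v ^ i * PowerSeries.coeff 0 w / i.factorial)) := by
  have hinv : Tendsto (fun n : ℕ => ((n : ℂ))⁻¹) atTop (𝓝 0) := tendsto_inv_atTop_nhds_zero_nat (𝕜 := ℂ)
  have h1 : ∀ l ∈ Finset.range (i + 1), Tendsto (fun n : ℕ =>
      (((n - s).choose l : ℂ) / (n : ℂ) ^ l) * ((n : ℂ)⁻¹) ^ (i - l) *
        PowerSeries.coeff (i - l) (v ^ l * w)) atTop
      (𝓝 (1 / l.factorial * 0 ^ (i - l) * PowerSeries.coeff (i - l) (v ^ l * w))) := fun l _ =>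
    ((tendsto_choose_sub_div_pow s l).mul (hinv.pow _)).mul_const _
  have h2 := tendsto_finsetSum _ h1
  -- The `l`-th term has order `nˡ`, so only `l = i` survives division by `nⁱ`.
  rw [Finset.sum_range_succ, Finset.sum_eq_zero (fun l hl => by
    rw [zero_pow (by have := Finset.mem_range.1 hl; omega)]; ring), Nat.sub_self, pow_zero,
    zero_add] at h2
  have h3 : 1 / (i.factorial : ℂ) * 1 * PowerSeries.coeff 0 (v ^ i * w) =
      PowerSeries.coeff 0 v ^ i * PowerSeries.coeff 0 w / i.factorial := by
    simp only [PowerSeries.coeff_zero_eq_constantCoeff_apply, map_mul, map_pow]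
    ring
  rw [h3] at h2
  refine h2.congr' ?_
  filter_upwards [eventually_gt_atTop 0] with n hn
  have hn0 : (n : ℂ) ≠ 0 := by exact_mod_cast hn.ne'
  rw [PowerSeries.coeff_one_add_X_mul_pow_mul, Finset.sum_div]
  refine Finset.sum_congr rfl fun l hl => ?_
  have h4 : (n : ℂ) ^ i = (n : ℂ) ^ l * (n : ℂ) ^ (i - l) := by
    rw [← pow_add, Nat.add_sub_cancel' (by have := Finset.mem_range.1 hl; omega)]
  rw [h4, inv_pow]
  field_simp

/-- The solution of the triangular system `∑ j ≤ m, a j * u j (m - j) = δ₀ₘ` with `u j 0 = 1`. -/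
noncomputable def triangularSolution (u : ℕ → ℕ → ℂ) (m : ℕ) : ℂ :=
  (if m = 0 then 1 else 0) - ∑ j : Fin m, triangularSolution u j * u j (m - j)

theorem triangularSolution_eq (u : ℕ → ℕ → ℂ) (m : ℕ) : triangularSolution u m =
    (if m = 0 then 1 else 0) - ∑ j ∈ Finset.range m, triangularSolution u j * u j (m - j) := by
  rw [triangularSolution, Finset.sum_range]

/-- This is `(-2 + 2)ᵐ = 0` expanded, i.e. the coefficient form of `exp (-2x) * exp (2x) = 1`. -/
theorem sum_neg_two_pow_mul_two_pow {m : ℕ} (hm : m ≠ 0) :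
    ∑ j ∈ Finset.range m, ((-2 : ℂ) ^ j / j.factorial) * (2 ^ (m - j) / (m - j).factorial) =
      -((-2) ^ m / m.factorial) := by
  have h1 := add_pow (-2 : ℂ) 2 m
  rw [neg_add_cancel, zero_pow hm] at h1
  have h2 : ∑ j ∈ Finset.range (m + 1), ((-2 : ℂ) ^ j / j.factorial) *
      (2 ^ (m - j) / (m - j).factorial) = 0 := by
    rw [← zero_div (m.factorial : ℂ), h1, Finset.sum_div]
    refine Finset.sum_congr rfl fun j hj => ?_
    rw [Nat.cast_choose ℂ (by have := Finset.mem_range.1 hj; omega)]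
    have := Nat.cast_ne_zero (R := ℂ).2 m.factorial_ne_zero
    field_simp
  rw [Finset.sum_range_succ, Nat.sub_self] at h2
  simp only [pow_zero, Nat.factorial_zero, Nat.cast_one, div_one, mul_one] at h2
  linear_combination h2

/-- After scaling by powers of `n`, the recursion tends to the one inverting the series of `exp
(2x)`, whose solution is the series of `exp (-2x)`. -/
theorem tendsto_triangularSolution_div_pow {u : ℕ → ℕ → ℕ → ℂ}
    (hu : ∀ j i, Tendsto (fun n : ℕ => u n j i / (n : ℂ) ^ i) atTop (𝓝 (2 ^ i / i.factorial)))
    (m : ℕ) : Tendsto (fun n : ℕ => triangularSolution (u n) m / (n : ℂ) ^ m) atTop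
      (𝓝 ((-2) ^ m / m.factorial)) := by
  induction m using Nat.strong_induction_on with
  | _ m ih =>
    rcases Nat.eq_zero_or_pos m with rfl | hm
    · have h0 : ∀ n, triangularSolution (u n) 0 = 1 := fun n => by
        rw [triangularSolution_eq]; simp
      simp [h0]
    · have h1 := tendsto_finsetSum (Finset.range m) fun j hj =>
        (ih j (Finset.mem_range.1 hj)).mul (hu j (m - j))
      rw [sum_neg_two_pow_mul_two_pow hm.ne'] at h1
      have h2 := h1.neg
      rw [neg_neg] at h2
      refine h2.congr' ?_
      filter_upwards [eventually_gt_atTop 0] with n hn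
      have hn0 : (n : ℂ) ≠ 0 := by exact_mod_cast hn.ne'
      rw [triangularSolution_eq, if_neg hm.ne', zero_sub, neg_div, Finset.sum_div]
      congr 1
      refine Finset.sum_congr rfl fun j hj => ?_
      have h4 : (n : ℂ) ^ m = (n : ℂ) ^ j * (n : ℂ) ^ (m - j) := by
        rw [← pow_add, Nat.add_sub_cancel' (Finset.mem_range.1 hj).le]
      rw [h4]
      field_simp

/-! ### The coefficients in the expansion of the theta series -/

/-- The coefficient of `q ^ (i + j)` in `θ₃ⁿ⁻⁸ʲ Δ₈ʲ`. -/
noncomputable def basisCoeff (n j i : ℕ) : ℂ :=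
  PowerSeries.coeff i (taylorSeries squareSeries ^ (n - 8 * j) * taylorSeries deltaEightSeries ^ j)

theorem exists_taylorSeries_squareSeries : ∃ v : PowerSeries ℂ, PowerSeries.coeff 0 v = 2 ∧
    taylorSeries squareSeries = 1 + PowerSeries.X * v := by
  obtain ⟨R, hR, hR0, h⟩ := exists_squareSeries_eq
  refine ⟨taylorSeries R, by rw [coeff_zero_taylorSeries, hR0], ?_⟩
  have hid : AnalyticAt ℂ (fun q : ℂ => q) 0 := analyticAt_id
  have h1 : squareSeries =ᶠ[𝓝 0] (fun _ => 1) + (fun q => q) * R := by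
    filter_upwards [Metric.ball_mem_nhds (0 : ℂ) one_pos] with q hq
    exact h q (by simpa using hq)
  rw [taylorSeries_congr h1, taylorSeries_add analyticAt_const (hid.mul hR),
    taylorSeries_mul hid hR, taylorSeries_const, taylorSeries_id, map_one]

theorem tendsto_basisCoeff_div_pow (j i : ℕ) :
    Tendsto (fun n : ℕ => basisCoeff n j i / (n : ℂ) ^ i) atTop (𝓝 (2 ^ i / i.factorial)) := by
  obtain ⟨v, hv, h⟩ := exists_taylorSeries_squareSeries
  have h1 := tendsto_coeff_pow_div_pow v (taylorSeries deltaEightSeries ^ j) (8 * j) i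
  have h2 : PowerSeries.coeff 0 (taylorSeries deltaEightSeries ^ j) = 1 := by
    have h3 := coeff_zero_taylorSeries deltaEightSeries
    rw [deltaEightSeries_zero, PowerSeries.coeff_zero_eq_constantCoeff_apply] at h3
    rw [PowerSeries.coeff_zero_eq_constantCoeff_apply, map_pow, h3, one_pow]
  rw [hv, h2, mul_one, ← h] at h1
  exact h1

theorem basisCoeff_zero (n j : ℕ) : basisCoeff n j 0 = 1 := by
  have h1 := coeff_zero_taylorSeries deltaEightSeries
  have h2 := coeff_zero_taylorSeries squareSeries
  rw [deltaEightSeries_zero, PowerSeries.coeff_zero_eq_constantCoeff_apply] at h1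
  rw [squareSeries_zero, PowerSeries.coeff_zero_eq_constantCoeff_apply] at h2
  rw [basisCoeff, PowerSeries.coeff_zero_eq_constantCoeff_apply, map_mul, map_pow, map_pow, h1, h2,
    one_pow, one_pow, one_mul]

/-- Comparison of coefficients in an expansion in the `θ₃ⁿ⁻⁸ʲ Δ₈ʲ`. -/
theorem coeff_eq_of_expansion {n k N : ℕ} {c : ℕ → ℂ} {R : ℂ → ℂ}
    (hR : AnalyticAt ℂ R 0) (hR0 : R 0 = N)
    (h : ∀ q : ℂ, q ≠ 0 → ‖q‖ < 1 → 1 + q ^ k * R q = ∑ j ∈ Finset.range (k + 1),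
      c j * (squareSeries q ^ (n - 8 * j) * (q * deltaEightSeries q) ^ j)) :
    (∀ j < k, c j = triangularSolution (basisCoeff n) j) ∧
      c k = triangularSolution (basisCoeff n) k + N := by
  have hid : AnalyticAt ℂ (fun q : ℂ => q) 0 := analyticAt_id
  have hE := analyticAt_deltaEightSeries
  have hS := analyticAt_squareSeries
  set L : ℂ → ℂ := (fun _ => 1) + (fun q => q) ^ k * R with hL
  set T : ℕ → ℂ → ℂ := fun j => (fun _ => c j) *
    (squareSeries ^ (n - 8 * j) * ((fun q => q) * deltaEightSeries) ^ j) with hT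
  have hTa : ∀ j, AnalyticAt ℂ (T j) 0 := fun j =>
    analyticAt_const.mul ((hS.pow _).mul ((hid.mul hE).pow _))
  have hLa : AnalyticAt ℂ L 0 := analyticAt_const.add ((hid.pow k).mul hR)
  have hLT : L =ᶠ[𝓝 0] ∑ j ∈ Finset.range (k + 1), T j := by
    -- The identity is known only for `q ≠ 0`, as `q` comes from `exp (πiz)`; continuity supplies
    -- the origin.
    refine (hLa.continuousAt.eventuallyEq_nhds_iff_eventuallyEq_nhdsNE
      (Finset.analyticAt_sum _ fun j _ => hTa j).continuousAt).1 ?_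
    filter_upwards [self_mem_nhdsWithin, mem_nhdsWithin_of_mem_nhds
      (Metric.ball_mem_nhds (0 : ℂ) one_pos)] with q hq0 hq
    have := h q hq0 (by simpa using hq)
    simpa [hL, hT] using this
  have hser := taylorSeries_congr hLT
  rw [taylorSeries_sum _ hTa, hL, taylorSeries_add analyticAt_const ((hid.pow k).mul hR),
    taylorSeries_mul (hid.pow k) hR, taylorSeries_pow hid, taylorSeries_const, taylorSeries_id,
    map_one] at hser
  have hTj : ∀ j, taylorSeries (T j) = PowerSeries.C (c j) * (PowerSeries.X ^ j *
      (taylorSeries squareSeries ^ (n - 8 * j) * taylorSeries deltaEightSeries ^ j)) := by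
    intro j
    simp only [hT]
    rw [taylorSeries_mul analyticAt_const ((hS.pow _).mul ((hid.mul hE).pow _)),
      taylorSeries_mul (hS.pow _) ((hid.mul hE).pow _), taylorSeries_pow hS,
      taylorSeries_pow (hid.mul hE), taylorSeries_mul hid hE, taylorSeries_id, taylorSeries_const]
    ring
  have hcoeff : ∀ m ≤ k, (if m = 0 then 1 else 0) + (if m = k then (N : ℂ) else 0) =
      c m + ∑ j ∈ Finset.range m, c j * basisCoeff n j (m - j) := by
    intro m hm
    have h1 := congrArg (PowerSeries.coeff m) hser
    rw [map_add, map_sum, PowerSeries.coeff_one, PowerSeries.coeff_X_pow_mul'] at h1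
    have h2 : (if k ≤ m then PowerSeries.coeff (m - k) (taylorSeries R) else 0) =
        if m = k then (N : ℂ) else 0 := by
      by_cases hmk : m = k
      · rw [if_pos hmk.ge, if_pos hmk, hmk, Nat.sub_self, coeff_zero_taylorSeries, hR0]
      · rw [if_neg hmk, if_neg (by omega)]
    rw [h2] at h1
    rw [h1]
    have h3 : ∀ j, PowerSeries.coeff m (taylorSeries (T j)) =
        if j ≤ m then c j * basisCoeff n j (m - j) else 0 := by
      intro j
      rw [hTj, PowerSeries.coeff_C_mul, PowerSeries.coeff_X_pow_mul', mul_ite, mul_zero]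
      rfl
    simp only [h3]
    rw [← Finset.sum_subset (Finset.range_mono (by omega : m + 1 ≤ k + 1)) (fun j _ hj => by
      rw [if_neg]; rw [Finset.mem_range] at hj; omega), Finset.sum_range_succ, if_pos le_rfl,
      Nat.sub_self, basisCoeff_zero, mul_one, add_comm]
    congr 1
    refine Finset.sum_congr rfl fun j hj => ?_
    rw [if_pos (Finset.mem_range.1 hj).le]
  have hlow : ∀ j < k, c j = triangularSolution (basisCoeff n) j := by
    intro j
    induction j using Nat.strong_induction_on with
    | _ j ih =>
      intro hj
      have h1 := hcoeff j hj.le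
      rw [if_neg hj.ne, add_zero, Finset.sum_congr rfl fun i hi => by
        rw [ih i (Finset.mem_range.1 hi) ((Finset.mem_range.1 hi).trans hj)]] at h1
      rw [triangularSolution_eq, h1]
      ring
  refine ⟨hlow, ?_⟩
  have h1 := hcoeff k le_rfl
  rw [if_pos rfl, Finset.sum_congr rfl fun i hi => by rw [hlow i (Finset.mem_range.1 hi)]] at h1
  rw [triangularSolution_eq]
  linear_combination -h1

end

section
-- A bound for the number of minimal vectors of odd norm.
section Kissing
open MvPolynomial

/-- Take `T` of maximal size among the subsets without distinct antipodal pairs; maximality forces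
`S ⊆ T ∪ -T`. -/
theorem exists_half_of_neg_closed {E : Type*} [AddCommGroup E] (S : Finset E) :
    ∃ T ⊆ S, (∀ x ∈ T, ∀ y ∈ T, x ≠ y → x ≠ -y) ∧ S.card ≤ 2 * T.card := by
  classical
  obtain ⟨T, hT, hmax⟩ := Finset.exists_max_image
    (S.powerset.filter fun T => ∀ x ∈ T, ∀ y ∈ T, x ≠ y → x ≠ -y) Finset.card
    ⟨∅, by simp⟩
  rw [Finset.mem_filter, Finset.mem_powerset] at hT
  refine ⟨T, hT.1, hT.2, ?_⟩
  have hsub : S ⊆ T ∪ T.image (fun x => -x) := by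
    intro x hx
    by_contra hxT
    simp only [Finset.mem_union, Finset.mem_image, not_or, not_exists, not_and] at hxT
    have h1 := hmax (insert x T) (by
      rw [Finset.mem_filter, Finset.mem_powerset]
      refine ⟨Finset.insert_subset hx hT.1, ?_⟩
      intro a ha b hb hab
      rcases Finset.mem_insert.1 ha with ha' | ha'
      · rcases Finset.mem_insert.1 hb with hb' | hb'
        · exact absurd (ha'.trans hb'.symm) hab
        · exact fun h => hxT.2 b hb' (h.symm.trans ha')
      · rcases Finset.mem_insert.1 hb with hb' | hb'
        · exact fun h => hxT.2 a ha' (by rw [h, neg_neg, hb'])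
        · exact hT.2 a ha' b hb' hab)
    rw [Finset.card_insert_of_notMem hxT.1] at h1
    omega
  calc S.card ≤ _ := Finset.card_le_card hsub
    _ ≤ _ := Finset.card_union_le _ _
    _ ≤ T.card + T.card := Nat.add_le_add_left Finset.card_image_le _
    _ = _ := by ring

/-- Homogeneous polynomials that form a dual system with a family of points are at most as many as
the monomials of their degree. -/
theorem card_le_of_homogeneous_dual {ι : Type*} [Fintype ι] {n k : ℕ}
    (F : ι → MvPolynomial (Fin n) ℝ) (hF : ∀ i, (F i).IsHomogeneous k) (p : ι → Fin n → ℝ)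
    (hne : ∀ i, eval (p i) (F i) ≠ 0) (hz : ∀ i j, i ≠ j → eval (p j) (F i) = 0) :
    Fintype.card ι ≤ (n + k - 1).choose k := by
  classical
  let I := Finset.finsuppAntidiag (Finset.univ : Finset (Fin n)) k
  have hli : LinearIndependent ℝ (fun i => fun d : I => coeff d.1 (F i)) := by
    rw [Fintype.linearIndependent_iff]
    intro g hg j
    have h0 : ∑ i, g i • F i = 0 := by
      ext d
      rw [coeff_sum, coeff_zero]
      by_cases hd : d ∈ I
      · have := congrFun hg ⟨d, hd⟩
        simpa [coeff_smul] using this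
      · refine Finset.sum_eq_zero fun i _ => ?_
        rw [coeff_smul, (hF i).coeff_eq_zero, smul_zero]
        intro h
        refine hd ?_
        rw [Finset.mem_finsuppAntidiag]
        refine ⟨?_, Finset.subset_univ _⟩
        rw [← h, Finsupp.degree_eq_sum]
    have h1 := congrArg (eval (p j)) h0
    rw [map_sum, Finset.sum_eq_single j] at h1
    · rw [smul_eval, map_zero] at h1
      exact (mul_eq_zero.1 h1).resolve_right (hne j)
    · intro i _ hij
      rw [smul_eval, hz i j hij, mul_zero]
    · simp
  have h2 := hli.fintype_card_le_finrank
  rw [Module.finrank_fintype_fun_eq_card, Fintype.card_coe] at h2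
  have h3 : I.card = (n + k - 1).choose k := by
    simpa using Finset.card_finsuppAntidiag_nat_eq_choose (s := (Finset.univ : Finset (Fin n))) k
  omega

theorem card_le_two_mul_choose_of_inner {n s : ℕ} (S : Finset (EuclideanSpace ℝ (Fin n)))
    (hS : ∀ x ∈ S, ‖x‖ ^ 2 = (2 * s + 1 : ℕ))
    (hin : ∀ x ∈ S, ∀ y ∈ S, x ≠ y → x ≠ -y → ∃ a : ℤ, inner ℝ x y = (a : ℝ) ∧ |a| ≤ s) :
    S.card ≤ 2 * (n + (2 * s + 1) - 1).choose (2 * s + 1) := by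
  obtain ⟨T, hTS, hT, hcard⟩ := exists_half_of_neg_closed S
  let L : EuclideanSpace ℝ (Fin n) → MvPolynomial (Fin n) ℝ := fun x => ∑ i, C (x i) * X i
  let Q : MvPolynomial (Fin n) ℝ := ∑ i, X i ^ 2
  -- On `S` the form `Q / (2s + 1)` equals `1`, so it homogenizes the factors `(x, y)² - (i + 1)²`.
  -- These kill the inner products `±1, …, ±s`, and `L x` kills `0`; the degree is exactly `2s + 1`.
  -- At `y = x` the inner product is `2s + 1` and no factor vanishes.
  let F : T → MvPolynomial (Fin n) ℝ := fun x => L x * ∏ i ∈ Finset.range s,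
    (L x ^ 2 - C (((i : ℝ) + 1) ^ 2 / (2 * s + 1 : ℕ)) * Q)
  have hL : ∀ x, (L x).IsHomogeneous 1 := fun x =>
    IsHomogeneous.sum _ _ _ fun i _ => by simpa using (isHomogeneous_C _ (x i)).mul (isHomogeneous_X ℝ i)
  have hQ : Q.IsHomogeneous 2 := IsHomogeneous.sum _ _ _ fun i _ => by
    simpa using (isHomogeneous_X ℝ i).pow 2
  have hLe : ∀ x y : EuclideanSpace ℝ (Fin n), eval y (L x) = inner ℝ x y := by
    intro x y
    simp [L, PiLp.inner_apply, mul_comm]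
  have hQe : ∀ y : EuclideanSpace ℝ (Fin n), eval y Q = ‖y‖ ^ 2 := by
    intro y
    simp [Q, EuclideanSpace.norm_sq_eq]
  have hFe : ∀ x y : T, eval (y : EuclideanSpace ℝ (Fin n)) (F x) =
      inner ℝ (x : EuclideanSpace ℝ (Fin n)) y * ∏ i ∈ Finset.range s,
        (inner ℝ (x : EuclideanSpace ℝ (Fin n)) y ^ 2 - ((i : ℝ) + 1) ^ 2) := by
    intro x y
    simp only [F, map_mul, map_prod, map_sub, map_pow, eval_C, hLe, hQe]
    congr 1
    refine Finset.prod_congr rfl fun i _ => ?_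
    rw [hS y (hTS y.2), div_mul_cancel₀]
    positivity
  have h := card_le_of_homogeneous_dual (k := 2 * s + 1) F (fun x => by
      have h1 : (∏ i ∈ Finset.range s,
          (L x ^ 2 - C (((i : ℝ) + 1) ^ 2 / (2 * s + 1 : ℕ)) * Q)).IsHomogeneous
            (∑ i ∈ Finset.range s, 2) :=
        IsHomogeneous.prod _ _ _ fun i _ => by
          refine IsHomogeneous.sub ?_ ?_
          · simpa using (hL x).pow 2
          · simpa using (isHomogeneous_C _ _).mul hQ
      have h2 := (hL x).mul h1
      rw [Finset.sum_const, Finset.card_range, smul_eq_mul] at h2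
      rwa [show 2 * s + 1 = 1 + s * 2 by ring]) (fun x => (x : EuclideanSpace ℝ (Fin n)))
    (fun x => by
      rw [hFe, real_inner_self_eq_norm_sq, hS x (hTS x.2)]
      refine mul_ne_zero (by positivity) (Finset.prod_ne_zero_iff.2 fun i hi => ?_)
      have hi' : (i : ℝ) + 1 ≤ s := by exact_mod_cast Finset.mem_range.1 hi
      push_cast
      nlinarith [(Nat.cast_nonneg i : (0 : ℝ) ≤ i)])
    (fun x y hxy => by
      have hxy' : (x : EuclideanSpace ℝ (Fin n)) ≠ y := fun h => hxy (Subtype.ext h)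
      obtain ⟨a, ha, has⟩ := hin x (hTS x.2) y (hTS y.2) hxy' (hT x x.2 y y.2 hxy')
      rw [hFe, ha]
      by_cases ha0 : a = 0
      · simp [ha0]
      · refine mul_eq_zero_of_right _ (Finset.prod_eq_zero (i := a.natAbs - 1) ?_ ?_)
        · have has' := abs_le.1 has
          rw [Finset.mem_range]; omega
        · have h1 : 1 ≤ a.natAbs := by omega
          rw [Nat.cast_sub h1, Nat.cast_one, sub_add_cancel, Nat.cast_natAbs]
          norm_cast
          rw [sq_abs, sub_self])
  rw [Fintype.card_coe] at h
  omega

end Kissing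

end

section
open Complex Filter Topology

/-! ### The lattice `ℤⁿ` -/

theorem covolume_integerLattice (n : ℕ) : ZLattice.covolume (integerLattice n) = 1 := by
  classical
  set b := EuclideanSpace.basisFun (Fin n) ℝ with hb
  have hspan : integerLattice n = Submodule.span ℤ (Set.range b.toBasis) := by
    rw [integerLattice, OrthonormalBasis.coe_toBasis]
  rw [hspan, ZLattice.covolume_eq_measure_fundamentalDomain _ _
    (ZSpan.isAddFundamentalDomain b.toBasis MeasureTheory.volume),
    MeasureTheory.measureReal_congr (ZSpan.fundamentalDomain_ae_parallelepiped b.toBasis _),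
    MeasureTheory.measureReal_def, OrthonormalBasis.coe_toBasis,
    OrthonormalBasis.volume_parallelepiped, ENNReal.toReal_one]

theorem isUnimodularLattice_integerLattice (n : ℕ) : IsUnimodularLattice (integerLattice n) where
  discrete := by
    have h : integerLattice n =
        Submodule.span ℤ (Set.range (EuclideanSpace.basisFun (Fin n) ℝ).toBasis) := by
      rw [integerLattice, OrthonormalBasis.coe_toBasis]
    rw [h]
    infer_instance
  spans := by
    rw [integerLattice, Submodule.span_span_of_tower, ← OrthonormalBasis.coe_toBasis,
      Module.Basis.span_eq]
  integral := by
    intro x hx y hy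
    refine Submodule.span_induction₂ (p := fun x y _ _ => ∃ m : ℤ, inner ℝ x y = (m : ℝ))
      ?_ ?_ ?_ ?_ ?_ ?_ ?_ hx hy
    · rintro _ _ ⟨i, rfl⟩ ⟨j, rfl⟩
      rw [orthonormal_iff_ite.1 (EuclideanSpace.basisFun (Fin n) ℝ).orthonormal]
      split_ifs
      exacts [⟨1, by simp⟩, ⟨0, by simp⟩]
    · exact fun y _ => ⟨0, by simp⟩
    · exact fun y _ => ⟨0, by simp⟩
    · rintro x y z _ _ _ ⟨a, ha⟩ ⟨c, hc⟩
      exact ⟨a + c, by rw [inner_add_left, ha, hc, Int.cast_add]⟩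
    · rintro x y z _ _ _ ⟨a, ha⟩ ⟨c, hc⟩
      exact ⟨a + c, by rw [inner_add_right, ha, hc, Int.cast_add]⟩
    · rintro r x y _ _ ⟨a, ha⟩
      exact ⟨r * a, by rw [← Int.cast_smul_eq_zsmul ℝ, real_inner_smul_left, ha, Int.cast_mul]⟩
    · rintro r x y _ _ ⟨a, ha⟩
      exact ⟨r * a, by rw [← Int.cast_smul_eq_zsmul ℝ, real_inner_smul_right, ha, Int.cast_mul]⟩
  covolume_eq_one := covolume_integerLattice n

/-- Testing against the standard basis shows that a characteristic vector of `ℤⁿ` has odd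
coordinates. -/
theorem isNSubEightLattice_integerLattice (n : ℕ) : IsNSubEightLattice 0 (integerLattice n) where
  unimodular := isUnimodularLattice_integerLattice n
  le_norm_sq := by
    rintro w ⟨hw, hw2⟩
    have h1 : ∀ i, (1 : ℝ) ≤ ‖w i‖ ^ 2 := by
      intro i
      obtain ⟨a, ha⟩ := hw2 _ (Submodule.subset_span ⟨i, rfl⟩)
      rw [real_inner_self_eq_norm_sq, OrthonormalBasis.norm_eq_one,
        EuclideanSpace.basisFun_apply, EuclideanSpace.inner_single_right] at ha
      have hwi : w i = ((2 * a + 1 : ℤ) : ℝ) := by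
        push_cast
        simp at ha
        linarith
      rw [hwi, Real.norm_eq_abs, sq_abs]
      have h2 : (1 : ℤ) ≤ (2 * a + 1) ^ 2 := by
        have : (2 * a + 1) ≠ 0 := by omega
        have := pow_pos (abs_pos.2 this) 2
        rw [sq_abs] at this
        omega
      exact_mod_cast h2
    rw [EuclideanSpace.norm_sq_eq]
    calc (n : ℝ) - 8 * ((0 : ℕ) : ℝ) = ∑ i : Fin n, (1 : ℝ) := by simp
      _ ≤ _ := Finset.sum_le_sum fun i _ => h1 i

/-! ### Values on the imaginary axis -/

theorem SubexpExponents.exists_countSeries_ofReal {ι : Type*} {m : ι → ℕ} (h : SubexpExponents m)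
    {i₀ : ι} (h0 : m i₀ = 0) {r : ℝ} (hr0 : 0 < r) (hr1 : r < 1) :
    ∃ t : ℝ, 1 ≤ t ∧ countSeries m r = t := by
  refine ⟨∑' i, r ^ m i, ?_, ?_⟩
  · have := (h r hr0 hr1).le_tsum i₀ fun j _ => by positivity
    simpa [h0] using this
  · rw [countSeries, ofReal_tsum]
    exact tsum_congr fun i => by push_cast; rfl

theorem exp_pi_I_mul_mul_I (c y : ℝ) :
    exp (Real.pi * I * c * (y * I)) = (Real.exp (-(Real.pi * c * y)) : ℝ) := by
  rw [ofReal_exp]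
  congr 1
  push_cast
  linear_combination (Real.pi * c * y : ℂ) * I_mul_I

namespace IsUnimodularLattice

variable {n : ℕ} {Λ : Submodule ℤ (EuclideanSpace ℝ (Fin n))}

theorem exists_latticeTheta_eq_countSeries (h : IsUnimodularLattice Λ) :
    ∃ m : Λ → ℕ, (∀ x : Λ, ‖(x : EuclideanSpace ℝ (Fin n))‖ ^ 2 = m x) ∧ SubexpExponents m ∧
      ∀ z, latticeTheta Λ z = countSeries m (exp (Real.pi * I * z)) := by
  choose m hm using fun x : Λ => h.exists_norm_sq_eq_natCast x.2
  have hm' : ∀ x : Λ, ‖(x : EuclideanSpace ℝ (Fin n)) + 0‖ ^ 2 = (0 : ℝ) + (1 : ℝ) * m x := by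
    intro x
    rw [add_zero, hm, zero_add, one_mul]
  refine ⟨m, hm, h.subexpExponents 0 one_pos hm', fun z => ?_⟩
  rw [latticeTheta_eq_shiftedTheta, shiftedTheta_eq_countSeries hm']
  simp

theorem exists_one_le_latticeTheta (h : IsUnimodularLattice Λ) {y : ℝ} (hy : 0 < y) :
    ∃ t : ℝ, 1 ≤ t ∧ latticeTheta Λ (y * I) = t := by
  obtain ⟨m, hm, hs, hΘ⟩ := h.exists_latticeTheta_eq_countSeries
  have h0 : m 0 = 0 := by
    have := hm 0
    simpa using this.symm
  have h1 := exp_pi_I_mul_mul_I 1 y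
  rw [ofReal_one, mul_one, mul_one] at h1
  rw [hΘ, h1]
  refine hs.exists_countSeries_ofReal h0 (Real.exp_pos _) ?_
  rw [Real.exp_lt_one_iff]
  have := mul_pos Real.pi_pos hy
  linarith

theorem tendsto_latticeTheta (h : IsUnimodularLattice Λ) :
    Tendsto (fun y : ℝ => latticeTheta Λ (y * I)) atTop (𝓝 1) := by
  obtain ⟨m, hm, hs, hΘ⟩ := h.exists_latticeTheta_eq_countSeries
  have h0 : {x | m x = 0} = {0} := by
    ext x
    have := hm x
    simp only [Set.mem_ofPred_eq, Set.mem_singleton_iff]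
    rw [← @Nat.cast_eq_zero ℝ, ← this]
    simp
  have h1 := hs.countSeries_zero
  rw [h0, Set.ncard_singleton, Nat.cast_one] at h1
  have h2 := hs.analyticAt.continuousAt.tendsto.comp (tendsto_exp_mul_I_atTop Real.pi_pos)
  rw [h1] at h2
  exact h2.congr fun y => (hΘ _).symm

end IsUnimodularLattice

/-- The expansion for `k = 0` has a single term, and the limit at `i∞` shows that its coefficient is
`1`. -/
theorem latticeTheta_integerLattice {n : ℕ} {z : ℂ} (hz : 0 < z.im) :
    latticeTheta (integerLattice n) z = jacobiThetaThree z ^ n := by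
  obtain ⟨c, hc⟩ := (isNSubEightLattice_integerLattice n).exists_theta_expansion (by omega)
  simp only [zero_add, Finset.sum_range_one, pow_zero, mul_one, mul_zero, Nat.sub_zero] at hc
  have h1 : Tendsto (fun y : ℝ => c 0 * jacobiThetaThree (y * I) ^ n) atTop (𝓝 (c 0)) := by
    have h2 := analyticAt_squareSeries.continuousAt.tendsto.comp
      (tendsto_exp_mul_I_atTop Real.pi_pos)
    rw [squareSeries_zero] at h2
    have h3 := (h2.pow n).const_mul (c 0)
    rw [one_pow, mul_one] at h3
    exact h3.congr fun y => by rw [jacobiThetaThree_eq]; rfl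
  have h4 : c 0 = 1 := by
    refine tendsto_nhds_unique h1 ?_
    refine (isUnimodularLattice_integerLattice n).tendsto_latticeTheta.congr' ?_
    filter_upwards [eventually_gt_atTop 0] with y hy
    exact hc _ (by simpa using hy)
  rw [hc z hz, h4, one_mul]

theorem exists_jacobiTheta_I : ∃ a b : ℝ, 0 < a ∧ 0 < b ∧ jacobiThetaThree I = a ∧
    deltaEight I = b := by
  obtain ⟨a, ha, ha'⟩ := (isUnimodularLattice_integerLattice 1).exists_one_le_latticeTheta one_pos
  rw [ofReal_one, one_mul, latticeTheta_integerLattice (by simp), pow_one] at ha'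
  -- The point `i` is fixed by the inversion, so `θ₄(i) = θ₂(i)` and `Δ₈(i) = θ₂(i)⁸ / 16 > 0`.
  have h4 := isThetaTriple_jacobi.B_inv I (by simp)
  rw [thetaFactor_I, one_pow, one_mul, show -1 / I = I by rw [div_I]; ring] at h4
  have h2 := jacobiThetaTwo_eq I
  have e1 := exp_pi_I_mul_mul_I (1 / 4) 1
  have e2 := exp_pi_I_mul_mul_I 2 1
  obtain ⟨t, ht, ht'⟩ := subexpExponents_triangular.exists_countSeries_ofReal (i₀ := 0)
    (by simp [triangular]) (Real.exp_pos (-(Real.pi * 2 * 1)))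
    (by rw [Real.exp_lt_one_iff]; have := Real.pi_pos; linarith)
  refine ⟨a, (Real.exp (-(Real.pi * (1 / 4) * 1)) * t) ^ 8 / 16, by linarith, ?_, ha', ?_⟩
  · have := Real.exp_pos (-(Real.pi * (1 / 4) * 1))
    positivity
  · have h5 : jacobiThetaTwo I = ((Real.exp (-(Real.pi * (1 / 4) * 1)) * t : ℝ) : ℂ) := by
      rw [h2, ofReal_mul, ← e1, ← ht', ← e2]
      congr 2
      · push_cast; ring
      · push_cast; congr 1; ring
    rw [deltaEight, h4, h5]
    push_cast
    ring

end

section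
open Complex Filter Topology

/-! ### The secrecy function of `n - 8k` lattices of large minimum -/

namespace IsNSubEightLattice

variable {n k : ℕ} {Λ : Submodule ℤ (EuclideanSpace ℝ (Fin n))}

theorem latticeTheta_eq_of_le_norm_sq (h : IsNSubEightLattice k Λ) (hk : 0 < k) (hn : 8 * k ≤ n)
    (hmin : ∀ v ∈ Λ, v ≠ 0 → (k : ℝ) ≤ ‖v‖ ^ 2) :
    ∃ S : Finset (EuclideanSpace ℝ (Fin n)), (∀ x ∈ S, x ∈ Λ ∧ ‖x‖ ^ 2 = k) ∧
      ∀ z : ℂ, 0 < z.im → latticeTheta Λ z = (∑ j ∈ Finset.range (k + 1),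
        triangularSolution (basisCoeff n) j * (jacobiThetaThree z ^ (n - 8 * j) * deltaEight z ^ j)) +
          S.card * (jacobiThetaThree z ^ (n - 8 * k) * deltaEight z ^ k) := by
  classical
  obtain ⟨c, hc⟩ := h.exists_theta_expansion hn
  obtain ⟨m, hm, hs, hΘ⟩ := h.unimodular.exists_latticeTheta_eq_countSeries
  obtain ⟨R, hR, hR0, hRq⟩ := hs.exists_countSeries_eq (i₀ := 0)
    (by simpa using (hm 0).symm) hk (fun x hx => by
      have := hmin x x.2 (by simpa using hx)
      rw [hm] at this
      exact_mod_cast this)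
  -- Every `q` with `0 < |q| < 1` is `exp (πiz)` for `z = log q / (πi)` in the upper half-plane, so
  -- the expansion in `z` becomes one in `q`.
  have hcoeff := coeff_eq_of_expansion (n := n) (c := c) hR hR0 (fun q hq0 hq1 => by
    rw [← hRq q hq1]
    have hpi : (Real.pi : ℂ) * I ≠ 0 := by simp [Real.pi_ne_zero]
    have hq : exp (Real.pi * I * (log q / (Real.pi * I))) = q := by
      rw [mul_div_cancel₀ _ hpi, exp_log hq0]
    have hz : 0 < (log q / (Real.pi * I)).im := by
      by_contra hcon
      have := norm_exp_pi_I_mul (log q / (Real.pi * I))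
      rw [hq] at this
      have h1 : (1 : ℝ) ≤ Real.exp (-Real.pi * (log q / (Real.pi * I)).im) := by
        rw [Real.one_le_exp_iff]
        nlinarith [Real.pi_pos]
      linarith
    have h2 := hc _ hz
    rw [hΘ, hq, jacobiThetaThree_eq, hq, deltaEight_eq, hq] at h2
    exact h2)
  refine ⟨((hs.finite_fiber k).toFinset).map (Function.Embedding.subtype _), ?_, ?_⟩
  · intro x hx
    simp only [Finset.mem_map, Set.Finite.mem_toFinset, Set.mem_ofPred_eq] at hx
    obtain ⟨y, hy, rfl⟩ := hx
    exact ⟨y.2, by simpa [hy] using hm y⟩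
  · intro z hz
    rw [hc z hz, Finset.card_map, ← Set.ncard_eq_toFinset_card _ (hs.finite_fiber k), Finset.sum_range_succ,
      Finset.sum_range_succ, hcoeff.2, add_mul, ← add_assoc]
    congr 2
    exact Finset.sum_congr rfl fun j hj => by rw [hcoeff.1 j (Finset.mem_range.1 hj)]

end IsNSubEightLattice

/-- The reciprocal of the secrecy function at `1` is a fixed sequence plus a fixed multiple of the
number of vectors of norm `k`. -/
theorem exists_inv_secrecyFunction_one (k : ℕ) (hk : 0 < k) :
    ∃ t : ℝ, 0 < t ∧ ∃ P : ℕ → ℝ,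
      Tendsto (fun n : ℕ => P n / n ^ k) atTop (𝓝 (t ^ k * ((-2) ^ k / k.factorial))) ∧
      ∀ (n : ℕ) (Λ : Submodule ℤ (EuclideanSpace ℝ (Fin n))), IsNSubEightLattice k Λ → 8 * k ≤ n →
        (∀ v ∈ Λ, v ≠ 0 → (k : ℝ) ≤ ‖v‖ ^ 2) →
        ∃ S : Finset (EuclideanSpace ℝ (Fin n)), (∀ x ∈ S, x ∈ Λ ∧ ‖x‖ ^ 2 = k) ∧
          0 < secrecyFunction Λ 1 ∧ (secrecyFunction Λ 1)⁻¹ = P n + S.card * t ^ k := by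
  obtain ⟨a, b, ha, hb, hθ, hΔ⟩ := exists_jacobiTheta_I
  refine ⟨b / a ^ 8, by positivity, fun n => (∑ j ∈ Finset.range (k + 1),
    triangularSolution (basisCoeff n) j * ((b / a ^ 8 : ℝ) : ℂ) ^ j).re, ?_, ?_⟩
  · have h1 : Tendsto (fun n : ℕ => ∑ j ∈ Finset.range (k + 1),
        triangularSolution (basisCoeff n) j / (n : ℂ) ^ j * (((b / a ^ 8 : ℝ) : ℂ) ^ j *
          ((n : ℂ)⁻¹) ^ (k - j))) atTop (𝓝 (∑ j ∈ Finset.range (k + 1),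
        (-2) ^ j / (j.factorial : ℂ) * (((b / a ^ 8 : ℝ) : ℂ) ^ j * 0 ^ (k - j)))) := by
      refine tendsto_finsetSum _ fun j _ => ?_
      refine (tendsto_triangularSolution_div_pow tendsto_basisCoeff_div_pow j).mul ?_
      exact (tendsto_inv_atTop_nhds_zero_nat.pow _).const_mul _
    rw [Finset.sum_range_succ, Finset.sum_eq_zero, zero_add, Nat.sub_self, pow_zero, mul_one] at h1
    · have h2 := (continuous_re.tendsto _).comp h1
      have e : ((-2) ^ k / (k.factorial : ℂ) * ((b / a ^ 8 : ℝ) : ℂ) ^ k).re =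
          (b / a ^ 8) ^ k * ((-2) ^ k / k.factorial) := by
        rw [mul_comm, ← ofReal_re ((b / a ^ 8) ^ k * ((-2) ^ k / k.factorial))]
        push_cast
        rfl
      rw [e] at h2
      refine h2.congr' ?_
      filter_upwards [eventually_ne_atTop 0] with n hn
      have hn' : (n : ℂ) ≠ 0 := Nat.cast_ne_zero.2 hn
      rw [Function.comp_apply, ← div_ofReal_re, Finset.sum_div]
      congr 1
      refine Finset.sum_congr rfl fun j hj => ?_
      have hj' : j ≤ k := by have := Finset.mem_range.1 hj; omega
      obtain ⟨i, rfl⟩ := Nat.exists_eq_add_of_le hj'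
      push_cast
      rw [Nat.add_sub_cancel_left, pow_add, inv_pow]
      field_simp
    · intro j hj
      have : k - j ≠ 0 := by have := Finset.mem_range.1 hj; omega
      rw [zero_pow this, mul_zero, mul_zero]
  · intro n Λ hΛ hn hmin
    obtain ⟨S, hS, hΘ⟩ := hΛ.latticeTheta_eq_of_le_norm_sq hk hn hmin
    obtain ⟨u, hu, hu'⟩ := hΛ.unimodular.exists_one_le_latticeTheta one_pos
    have hz := latticeTheta_integerLattice (n := n) (z := I) (by simp)
    have h1 := hΘ I (by simp)
    rw [ofReal_one, one_mul] at hu'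
    have hsec : secrecyFunction Λ 1 = a ^ n / u := by
      rw [secrecyFunction, ofReal_one, one_mul, hu', hz, hθ, ← ofReal_pow, ← ofReal_div, ofReal_re]
    have ha' : (a : ℂ) ≠ 0 := ofReal_ne_zero.2 ha.ne'
    refine ⟨S, hS, by rw [hsec]; positivity, ?_⟩
    have hpow : ∀ j ≤ k, (a : ℂ) ^ (n - 8 * j) * (b : ℂ) ^ j =
        a ^ n * ((b / a ^ 8 : ℝ) : ℂ) ^ j := by
      intro j hj
      obtain ⟨i, rfl⟩ := Nat.exists_eq_add_of_le (show 8 * j ≤ n by omega)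
      push_cast
      rw [Nat.add_sub_cancel_left, pow_add, div_pow, ← pow_mul]
      field_simp
    rw [hu', hθ, hΔ, hpow k le_rfl, Finset.sum_congr rfl fun j hj => by
      rw [hpow j (by have := Finset.mem_range.1 hj; omega), mul_left_comm], ← Finset.mul_sum,
      mul_left_comm, ← mul_add] at h1
    have h2 : ((u / a ^ n : ℝ) : ℂ) = (∑ j ∈ Finset.range (k + 1),
        triangularSolution (basisCoeff n) j * ((b / a ^ 8 : ℝ) : ℂ) ^ j) +
          ((S.card * (b / a ^ 8) ^ k : ℝ) : ℂ) := by
      rw [ofReal_div, h1, ofReal_pow, mul_div_cancel_left₀ _ (pow_ne_zero _ ha')]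
      push_cast
      rfl
    rw [hsec, inv_div, ← ofReal_re (u / a ^ n), h2, add_re, ofReal_re]

/-- Both theta series tend to `1` as `y → ∞`, so the maximum is at least the limit of the quotient.
-/
theorem BelfioreSoleConjecture.one_le_secrecyFunction (hBS : BelfioreSoleConjecture) {n : ℕ}
    {Λ : Submodule ℤ (EuclideanSpace ℝ (Fin n))} (h : IsUnimodularLattice Λ) :
    1 ≤ secrecyFunction Λ 1 := by
  have h1 := ((isUnimodularLattice_integerLattice n).tendsto_latticeTheta.div
    h.tendsto_latticeTheta one_ne_zero)
  rw [div_one] at h1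
  have h2 := (continuous_re.tendsto _).comp h1
  rw [one_re] at h2
  refine le_of_tendsto h2 ?_
  filter_upwards [eventually_gt_atTop 0] with y hy
  exact hBS n Λ h hy

/-- For minimal vectors `x ≠ ±y`, the norms of `x ± y` are at least `2s + 1`, whence `2 |(x, y)| ≤
2s + 1`. Integrality sharpens this to `|(x, y)| ≤ s`. -/
theorem card_le_of_odd_minimum {n s : ℕ} {Λ : Submodule ℤ (EuclideanSpace ℝ (Fin n))}
    (h : IsUnimodularLattice Λ)
    (hmin : ∀ v ∈ Λ, v ≠ 0 → ((2 * s + 1 : ℕ) : ℝ) ≤ ‖v‖ ^ 2)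
    {S : Finset (EuclideanSpace ℝ (Fin n))} (hS : ∀ x ∈ S, x ∈ Λ ∧ ‖x‖ ^ 2 = (2 * s + 1 : ℕ)) :
    S.card ≤ 2 * (n + (2 * s + 1) - 1).choose (2 * s + 1) := by
  refine card_le_two_mul_choose_of_inner S (fun x hx => (hS x hx).2) fun x hx y hy hxy hxy' => ?_
  obtain ⟨a, ha⟩ := h.integral x (hS x hx).1 y (hS y hy).1
  refine ⟨a, ha, ?_⟩
  have h1 := hmin _ (Λ.sub_mem (hS x hx).1 (hS y hy).1) (sub_ne_zero.2 hxy)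
  have h2 := hmin _ (Λ.add_mem (hS x hx).1 (hS y hy).1) fun h => hxy' (eq_neg_of_add_eq_zero_left h)
  rw [norm_sub_sq_real, (hS x hx).2, (hS y hy).2, ha] at h1
  rw [norm_add_sq_real, (hS x hx).2, (hS y hy).2, ha] at h2
  have h1' : 2 * a ≤ (2 * s + 1 : ℕ) := by
    have : 2 * (a : ℝ) ≤ (2 * s + 1 : ℕ) := by linarith
    exact_mod_cast this
  have h2' : -(2 * a) ≤ (2 * s + 1 : ℕ) := by
    have : -(2 * (a : ℝ)) ≤ (2 * s + 1 : ℕ) := by linarith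
    exact_mod_cast this
  rw [abs_le]
  push_cast at h1' h2'
  omega

theorem tendsto_choose_add_div_pow (k : ℕ) :
    Tendsto (fun n : ℕ => ((n + k - 1).choose k : ℝ) / n ^ k) atTop (𝓝 (1 / k.factorial)) := by
  have h1 : ∀ n : ℕ, ((n + k - 1).choose k : ℝ) / n ^ k =
      (∏ i ∈ Finset.range k, ((n : ℝ) + i) / n) / k.factorial := by
    intro n
    rw [Finset.prod_div_distrib, Finset.prod_const, Finset.card_range, div_right_comm]
    congr 1
    rw [eq_div_iff (by positivity), ← Nat.cast_mul, mul_comm, ← Nat.ascFactorial_eq_factorial_mul_choose']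
    rw [Nat.ascFactorial_eq_prod_range]
    push_cast
    rfl
  simp only [h1]
  refine Tendsto.div_const ?_ _
  have h2 : Tendsto (fun n : ℕ => ∏ i ∈ Finset.range k, ((n : ℝ) + i) / n) atTop
      (𝓝 (∏ i ∈ Finset.range k, (1 : ℝ))) := by
    refine tendsto_finsetProd _ fun i _ => ?_
    have h3 := (tendsto_const_div_atTop_nhds_zero_nat (i : ℝ)).const_add 1
    rw [add_zero] at h3
    refine h3.congr' ?_
    filter_upwards [eventually_ne_atTop 0] with n hn
    field_simp
  simpa using h2

end

/-! ### The contradiction for large dimension. -/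

open Filter Topology in
theorem mainTheorem7 (hBS : BelfioreSoleConjecture) (k : ℕ) (hk : 2 ≤ k) :
    ∃ N : ℕ, ∀ n : ℕ, N < n →
      ¬ ∃ Λ : Submodule ℤ (EuclideanSpace ℝ (Fin n)),
        IsNSubEightLattice k Λ ∧ ∀ v ∈ Λ, v ≠ 0 → (k : ℝ) ≤ ‖v‖ ^ 2 := by
  obtain ⟨t, ht, P, hP, hsec⟩ := exists_inv_secrecyFunction_one k (by omega)
  suffices hev : ∀ᶠ n : ℕ in atTop, ¬ ∃ Λ : Submodule ℤ (EuclideanSpace ℝ (Fin n)),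
      IsNSubEightLattice k Λ ∧ ∀ v ∈ Λ, v ≠ 0 → (k : ℝ) ≤ ‖v‖ ^ 2 by
    obtain ⟨N, hN⟩ := eventually_atTop.1 hev
    exact ⟨N, fun n hn => hN n hn.le⟩
  have htk : 0 < t ^ k / k.factorial := by positivity
  rcases Nat.even_or_odd k with hpar | ⟨s, rfl⟩
  -- Even `k`: the leading coefficient is positive, so eventually `P n > 1`, against `1 / Ξ(1) ≤ 1`.
  · have hlim : Tendsto (fun n : ℕ => P n / n ^ k - 1 / (n : ℝ) ^ k) atTop
        (𝓝 (t ^ k * ((-2) ^ k / k.factorial) - 0)) := by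
      refine hP.sub ?_
      have := (tendsto_inv_atTop_nhds_zero_nat (𝕜 := ℝ)).pow k
      rw [zero_pow (by omega)] at this
      exact this.congr fun n => by rw [inv_pow, one_div]
    have hpos : 0 < t ^ k * ((-2) ^ k / k.factorial) - 0 := by
      rw [hpar.neg_pow, sub_zero]
      positivity
    filter_upwards [hlim.eventually (lt_mem_nhds hpos), eventually_ge_atTop (8 * k)] with n hn hnk
    rintro ⟨Λ, hΛ, hmin⟩
    obtain ⟨S, hS, h0, h1⟩ := hsec n Λ hΛ hnk hmin
    have h2 := inv_le_one_of_one_le₀ (hBS.one_le_secrecyFunction hΛ.unimodular)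
    rw [h1] at h2
    rw [← sub_div] at hn
    have hn0 : 0 < (n : ℝ) ^ k := by
      have : 0 < n := by omega
      positivity
    have h3 : 0 < P n - 1 := by
      rcases div_pos_iff.1 hn with h | h
      · exact h.1
      · linarith [h.2]
    have : 0 ≤ S.card * t ^ k := by positivity
    linarith
  -- Odd `k`: even with the largest possible number of minimal vectors, the leading coefficient is a
  -- positive multiple of `2 - 2ᵏ = 2 (1 - 4ˢ)`. It is negative because `k ≥ 2` forces `s ≥ 1`.
  · have hlim := hP.add (((tendsto_choose_add_div_pow (2 * s + 1)).const_mul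
      2).mul_const (t ^ (2 * s + 1)))
    have hneg : t ^ (2 * s + 1) * ((-2) ^ (2 * s + 1) / ((2 * s + 1).factorial : ℝ)) +
        2 * (1 / ((2 * s + 1).factorial : ℝ)) * t ^ (2 * s + 1) < 0 := by
      have e : t ^ (2 * s + 1) * ((-2) ^ (2 * s + 1) / ((2 * s + 1).factorial : ℝ)) +
          2 * (1 / ((2 * s + 1).factorial : ℝ)) * t ^ (2 * s + 1) =
          t ^ (2 * s + 1) / (2 * s + 1).factorial * (2 * (1 - 4 ^ s)) := by
        rw [pow_succ (-2 : ℝ), pow_mul]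
        norm_num
        ring
      rw [e]
      refine mul_neg_of_pos_of_neg htk ?_
      have : (1 : ℝ) < 4 ^ s := one_lt_pow₀ (by norm_num) (by omega)
      linarith
    filter_upwards [hlim.eventually (gt_mem_nhds hneg), eventually_ge_atTop (8 * (2 * s + 1))]
      with n hn hnk
    rintro ⟨Λ, hΛ, hmin⟩
    obtain ⟨S, hS, h0, h1⟩ := hsec n Λ hΛ hnk hmin
    have hcard : (S.card : ℝ) ≤ 2 * (n + (2 * s + 1) - 1).choose (2 * s + 1) := by
      exact_mod_cast card_le_of_odd_minimum hΛ.unimodular hmin hS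
    have h2 := inv_pos.2 h0
    rw [h1] at h2
    have h3 : 0 < P n + 2 * (n + (2 * s + 1) - 1).choose (2 * s + 1) * t ^ (2 * s + 1) :=
      h2.trans_le (by gcongr)
    have hn0 : 0 < (n : ℝ) ^ (2 * s + 1) := by
      have : 0 < n := by omega
      positivity
    have h4 := div_pos h3 hn0
    have e : (P n + 2 * (n + (2 * s + 1) - 1).choose (2 * s + 1) * t ^ (2 * s + 1)) /
        (n : ℝ) ^ (2 * s + 1) = P n / n ^ (2 * s + 1) +
        2 * (((n + (2 * s + 1) - 1).choose (2 * s + 1) : ℝ) / n ^ (2 * s + 1)) *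
          t ^ (2 * s + 1) := by ring
    rw [e] at h4
    linarith
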